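/- For an integer $m\ge 0$ put $(x)_m=x(x+1)\cdots(x+m-1)$ (with $(x)_0=1$). For integers $s_1,\dots,s_m\ge 2$ put $$\zeta(s_1,\dots,s_m)=\sum_{k_1>\cdots>k_m\ge 1}\frac{1}{k_1^{s_1}\cdots k_m^{s_m}},\qquad \zeta^{\mathrm{as}}(s_1,\dots,s_m)=\sum_{\sigma\in\mathfrak S_m}\operatorname{sgn}(\sigma)\,\zeta(s_{\sigma(1)},\dots,s_{\sigma(m)}),$$ both being equal to $1$ when $m=0$. Let $n,r,t,\varepsilon\ge 0$ and $A,p\ge 1$ be integers with $n$ even, such that $$\varepsilon\equiv (A+1)(n+1)+1 \pmod 2\qquad\text{and}\qquad \varepsilon+(4r+2)p+2t\le (A-1)(n+1)+4r .$$ Then the series $$\sum_{k_1\ge\cdots\ge k_p\ge 1}\Big[\prod_{i=1}^p\big(k_i+\tfrac n2\big)\Big]^{\varepsilon}\, \frac{\Big[\prod_{1\le i<j\le p}(k_i-k_j-r)_{2r+1}\,(k_i+k_j+n-r)_{2r+1}\Big]\Big[\prod_{i=1}^p(k_i-t)_{2t+n+1}\Big]}{(k_1)_{n+1}^A\cdots(k_p)_{n+1}^A}$$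 converges (absolutely), and its sum is a linear combination with rational coefficients of products of the form $$\zeta(s_1)\cdots\zeta(s_q)\,\zeta^{\mathrm{as}}(s'_1,\dots,s'_{q'})$$ where $q,q'\ge 0$ are integers with $2q+q'\le p$, the $s_1,\dots,s_q,s'_1,\dots,s'_{q'}$ are odd integers $\ge 3$, $s_i\le 2A-1$ for all $i\in\{1,\dots,q\}$, and $s'_i\le A$ for all $i\in\{1,\dots,q'\}$. -/

import Mathlib

open scoped BigOperators

noncomputable section

/-- The multiple zeta series `ζ(s₁, …, s_p) = ∑_{k₁ > ⋯ > k_p ≥ 1} 1 / (k₁ ^ s₁ ⋯ k_p ^ s_p)`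
(equal to `1` when `p = 0`; depth one gives the values of the Riemann zeta function). -/
def multiZeta {p : ℕ} (s : Fin p → ℕ) : ℝ :=
  ∑' k : {k : Fin p → ℕ // StrictAnti k ∧ ∀ i, 1 ≤ k i}, ∏ i, 1 / (k.1 i : ℝ) ^ s i

/-- The antisymmetric multiple zeta value
`ζᵃˢ(s₁, …, s_p) = ∑_σ sign(σ) ζ(s_{σ(1)}, …, s_{σ(p)})`. -/
def antisymZeta {p : ℕ} (s : Fin p → ℕ) : ℝ :=
  ∑ σ : Equiv.Perm (Fin p), ((Equiv.Perm.sign σ : ℤ) : ℝ) * multiZeta (fun i => s (σ i))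

/-- The products `ζ(s₁) ⋯ ζ(s_q) ζᵃˢ(s'₁, …, s'_{q'})` with `2q + q' ≤ p`, all indices odd and
at least `3`, `s_i ≤ 2A - 1` and `s'_i ≤ A`. -/
def zetaProducts (A p : ℕ) : Set ℝ :=
  {x | ∃ (q q' : ℕ) (s : Fin q → ℕ) (s' : Fin q' → ℕ),
    2 * q + q' ≤ p ∧
    (∀ i, Odd (s i) ∧ 3 ≤ s i ∧ s i ≤ 2 * A - 1) ∧
    (∀ i, Odd (s' i) ∧ 3 ≤ s' i ∧ s' i ≤ A) ∧
    x = (∏ i, multiZeta ![s i]) * antisymZeta s'}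

/-- The Pochhammer symbol `(x)_m = x (x + 1) ⋯ (x + m - 1)`. -/
def poch (x : ℝ) (m : ℕ) : ℝ := (ascPochhammer ℝ m).eval x

/-- The general term of the series, at a `p`-tuple `k`. -/
def seriesTerm (n r t ε A p : ℕ) (k : Fin p → ℕ) : ℝ :=
  (∏ i, ((k i : ℝ) + (n : ℝ) / 2)) ^ ε *
    ((∏ i, ∏ j ∈ Finset.Ioi i,
        poch ((k i : ℝ) - k j - r) (2 * r + 1) * poch ((k i : ℝ) + k j + n - r) (2 * r + 1)) *
      ∏ i, poch ((k i : ℝ) - t) (2 * t + n + 1)) /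
    ∏ i, poch (k i : ℝ) (n + 1) ^ A

end

/-! Put n = 2N and use the centred variables x_i = k_i + N. Every Pochhammer symbol becomes a
`centralPoly`, an odd polynomial, so the summand changes by the sign under permutations of the k_i.
Hence it vanishes on tuples with a repeated entry, and p! times the sum over weakly decreasing
tuples is the sum over all tuples of `signProd` times the summand
(`IsSignEquivariant.tsum_antitone`).

The interaction factor is a polynomial in the squares x_i² (`aeval_pairPoly`). Expanding it in
monomials turns the summand into a combination of products of one-variable rational functions. The
parity of ε makes each of them odd, and the degree bound makes each decay at least quadratically
(`weightFun_mem`). It remains to treat `altSum g` for such functions.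

By partial fractions (`IsCentralRat.mem_oddRatSpan`), each g_i is a combination of powers 1/x^s with
s odd, 3 ≤ s ≤ A, and of odd functions u(x) - u(x - 1), where u is symmetric about -1/2. Extending
from x > N to x ≥ 1 adds only point masses, which are also differences. By multilinearity each g_i
may be taken to be one of these generators. If all are powers of 1/x, `altSum_zetaFun` gives an
antisymmetric multiple zeta value.

Otherwise some generator h is a difference H(k + 1) - H(k), and Schur's Pfaffian identity
(`altSum_cons`) expands along it. One term contains the sum of h, a rational number; the others
contain a pairing of h with a single g_i, times an alternating sum in two functions fewer. Summing
over the variable of h telescopes the pairing to a single sum of g_i(l) (H(0) - H(l) - H(l + 1))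
(`pairSum_sub_shift`). Beyond N, the sum of the two values of H is even in x, so g_i times it is
again odd, with poles of order at most 2A. The pairing is therefore a rational combination of 1 and
of zeta values at odd integers up to 2A - 1. Each pairing uses two functions and produces at most
one zeta value, whence 2q + q' ≤ p. -/

/-! ### Products of signs and Schur's Pfaffian identity -/

/-- The sign of `a - b`, as a real number. -/
noncomputable def orderSign (a b : ℕ) : ℝ := if b < a then 1 else if a < b then -1 else 0

/-- The product of the signs of `x i - x j` over `i < j`. -/
noncomputable def signProd {p : ℕ} (x : Fin p → ℕ) : ℝ :=
  ∏ i, ∏ j ∈ Finset.Ioi i, orderSign (x i) (x j)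

lemma orderSign_swap (a b : ℕ) : orderSign a b = -orderSign b a := by
  unfold orderSign; split_ifs <;> first | omega | simp

lemma orderSign_of_lt {a b : ℕ} (h : b < a) : orderSign a b = 1 := by simp [orderSign, h]

lemma orderSign_of_gt {a b : ℕ} (h : a < b) : orderSign a b = -1 := by
  simp [orderSign, h, h.le]

@[simp] lemma orderSign_self (a : ℕ) : orderSign a a = 0 := by simp [orderSign]

lemma abs_orderSign_le (a b : ℕ) : |orderSign a b| ≤ 1 := by
  unfold orderSign; split_ifs <;> simp

lemma orderSign_mul_self {a b : ℕ} (h : a ≠ b) : orderSign a b * orderSign a b = 1 := by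
  rcases lt_or_gt_of_ne h with h | h <;> simp [orderSign_of_lt, orderSign_of_gt, h]

lemma signProd_cons {p : ℕ} (y : ℕ) (x : Fin p → ℕ) :
    signProd (Fin.cons y x : Fin (p + 1) → ℕ) = (∏ i, orderSign y (x i)) * signProd x := by
  unfold signProd
  rw [Fin.prod_univ_succ, Fin.prod_Ioi_zero]
  simp [Fin.prod_Ioi_succ]

lemma signProd_comp_perm {p : ℕ} (x : Fin p → ℕ) (σ : Equiv.Perm (Fin p)) :
    signProd (x ∘ σ) = ((Equiv.Perm.sign σ : ℤ) : ℝ) * signProd x := by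
  unfold signProd
  simpa using σ.prod_Ioi_comp_eq_sign_mul_prod (R := ℝ) (f := fun i j => orderSign (x i) (x j))
    (fun i j => orderSign_swap _ _)

lemma signProd_eq_zero {p : ℕ} {x : Fin p → ℕ} (h : ¬ Function.Injective x) : signProd x = 0 := by
  simp only [Function.Injective, not_forall] at h
  obtain ⟨a, b, hab, hne⟩ := h
  have h1 := signProd_comp_perm x (Equiv.swap a b)
  have h2 : x ∘ Equiv.swap a b = x := by
    funext i
    simp only [Function.comp, Equiv.swap_apply_def]
    split_ifs with h3 h4 <;> simp_all
  rw [h2, Equiv.Perm.sign_swap hne] at h1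
  push_cast at h1
  linarith

lemma abs_signProd_le {p : ℕ} (x : Fin p → ℕ) : |signProd x| ≤ 1 := by
  unfold signProd
  rw [Finset.abs_prod]
  refine Finset.prod_le_one (fun _ _ => abs_nonneg _) fun i _ => ?_
  rw [Finset.abs_prod]
  exact Finset.prod_le_one (fun _ _ => abs_nonneg _) fun i _ => abs_orderSign_le _ _

lemma signProd_of_strictAnti {p : ℕ} {x : Fin p → ℕ} (h : StrictAnti x) : signProd x = 1 := by
  unfold signProd
  refine Finset.prod_eq_one fun i _ => Finset.prod_eq_one fun j hj => ?_
  exact orderSign_of_lt (h (Finset.mem_Ioi.1 hj))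

lemma signProd_insertNth {p : ℕ} (i : Fin (p + 1)) (z : ℕ) (y : Fin p → ℕ) :
    signProd (i.insertNth z y : Fin (p + 1) → ℕ)
      = (-1) ^ (i : ℕ) * (∏ j, orderSign z (y j)) * signProd y := by
  rw [← Fin.cons_comp_cycleRange, signProd_comp_perm, signProd_cons, Fin.sign_cycleRange]
  push_cast
  ring

/-- The i-th product is (-1) to the number of j with x j > x i, so in decreasing order of x i the
terms are 1, -1, 1, …. -/
lemma sum_prod_orderSign {ι : Type*} [DecidableEq ι] {x : ι → ℕ} (hx : Function.Injective x)
    (s : Finset ι) :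
    ∑ i ∈ s, ∏ j ∈ s.erase i, orderSign (x i) (x j) = if Even s.card then 0 else 1 := by
  induction s using Finset.induction_on_max_value x with
  | empty => simp
  | insert a s ha hmax ih =>
    have hlt : ∀ i ∈ s, x i < x a := fun i hi =>
      lt_of_le_of_ne (hmax i hi) fun h => ha (hx h ▸ hi)
    rw [Finset.sum_insert ha, Finset.erase_insert ha, Finset.card_insert_of_notMem ha]
    have h1 : ∏ j ∈ s, orderSign (x a) (x j) = 1 :=
      Finset.prod_eq_one fun j hj => orderSign_of_lt (hlt j hj)
    have h2 : ∑ i ∈ s, ∏ j ∈ (insert a s).erase i, orderSign (x i) (x j)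
        = -∑ i ∈ s, ∏ j ∈ s.erase i, orderSign (x i) (x j) := by
      rw [← Finset.sum_neg_distrib]
      refine Finset.sum_congr rfl fun i hi => ?_
      have hne : a ≠ i := fun h => ha (h ▸ hi)
      rw [Finset.erase_insert_of_ne hne, Finset.prod_insert (by simp [ha]),
        orderSign_of_gt (hlt i hi)]
      ring
    rw [h1, h2, ih]
    by_cases hs : Even s.card <;> simp [hs, Nat.even_add_one]

/-- As y varies, the left side is a step function that jumps at x i by twice the product over j ≠ i
on the right, and takes the mean value 0 there. The constant term is the mean (1 + (-1)^m)/2 of its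
two extreme values, m being the cardinality. -/
lemma prod_orderSign_eq {ι : Type*} [DecidableEq ι] {x : ι → ℕ} (hx : Function.Injective x)
    (y : ℕ) (s : Finset ι) :
    ∏ i ∈ s, orderSign y (x i) = (if Even s.card then 1 else 0) +
      ∑ i ∈ s, orderSign y (x i) * ∏ j ∈ s.erase i, orderSign (x i) (x j) := by
  induction s using Finset.induction_on_max_value x with
  | empty => simp
  | insert a s ha hmax ih =>
    have hlt : ∀ i ∈ s, x i < x a := fun i hi =>
      lt_of_le_of_ne (hmax i hi) fun h => ha (hx h ▸ hi)
    have hQ := sum_prod_orderSign hx (insert a s)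
    have hQs := sum_prod_orderSign hx s
    have h1 : ∏ j ∈ s, orderSign (x a) (x j) = 1 :=
      Finset.prod_eq_one fun j hj => orderSign_of_lt (hlt j hj)
    have h2 : ∀ i ∈ s, ∏ j ∈ (insert a s).erase i, orderSign (x i) (x j)
        = -∏ j ∈ s.erase i, orderSign (x i) (x j) := by
      intro i hi
      have hne : a ≠ i := fun h => ha (h ▸ hi)
      rw [Finset.erase_insert_of_ne hne, Finset.prod_insert (by simp [ha]),
        orderSign_of_gt (hlt i hi)]
      ring
    rcases lt_trichotomy y (x a) with h | h | h
    · rw [Finset.prod_insert ha, ih, Finset.sum_insert ha, Finset.erase_insert ha, h1,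
        Finset.card_insert_of_notMem ha, orderSign_of_gt h]
      have h3 : ∑ i ∈ s, orderSign y (x i) * ∏ j ∈ (insert a s).erase i, orderSign (x i) (x j)
          = -∑ i ∈ s, orderSign y (x i) * ∏ j ∈ s.erase i, orderSign (x i) (x j) := by
        rw [← Finset.sum_neg_distrib]
        exact Finset.sum_congr rfl fun i hi => by rw [h2 i hi, mul_neg]
      rw [h3]
      by_cases hs : Even s.card <;> simp [hs, Nat.even_add_one]
      ring
    · rw [Finset.prod_insert ha, Finset.sum_insert ha, h, orderSign_self,
        Finset.card_insert_of_notMem ha]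
      have h3 : ∑ i ∈ s, orderSign (x a) (x i) *
          ∏ j ∈ (insert a s).erase i, orderSign (x i) (x j)
          = -∑ i ∈ s, ∏ j ∈ s.erase i, orderSign (x i) (x j) := by
        rw [← Finset.sum_neg_distrib]
        exact Finset.sum_congr rfl fun i hi => by
          rw [h2 i hi, orderSign_of_lt (hlt i hi), one_mul]
      rw [h3, hQs]
      by_cases hs : Even s.card <;> simp [hs, Nat.even_add_one]
    · have h3 : ∀ i ∈ insert a s, orderSign y (x i) = 1 := by
        intro i hi
        rcases Finset.mem_insert.1 hi with rfl | hi
        · exact orderSign_of_lt h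
        · exact orderSign_of_lt ((hlt i hi).trans h)
      rw [Finset.prod_eq_one h3, Finset.sum_congr rfl fun i hi => by rw [h3 i hi, one_mul], hQ]
      by_cases hs : Even (insert a s).card <;> simp [hs]

/-- Expansion of `signProd` along its first entry (an instance of Schur's Pfaffian identity). -/
lemma signProd_cons_eq {m : ℕ} (y : ℕ) (x : Fin (m + 1) → ℕ) :
    signProd (Fin.cons y x : Fin (m + 2) → ℕ) =
      (if Even (m + 1) then 1 else 0) * signProd x +
        ∑ i : Fin (m + 1), (-1) ^ (i : ℕ) * orderSign y (x i) * signProd (i.removeNth x) := by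
  have hins : ∀ (i : Fin (m + 1)) (z : ℕ), (i.insertNth z (i.removeNth x) : Fin (m + 1) → ℕ)
      = Function.update x i z := fun i z => Fin.insertNth_removeNth i z x
  by_cases hx : Function.Injective x
  · rw [signProd_cons, prod_orderSign_eq hx y Finset.univ, add_mul, Finset.sum_mul]
    congr 1
    · simp
    refine Finset.sum_congr rfl fun i _ => ?_
    have h1 := signProd_insertNth i (x i) (i.removeNth x)
    rw [hins, Function.update_eq_self] at h1
    have h2 : ∏ j, orderSign (x i) (i.removeNth x j)
        = ∏ j ∈ Finset.univ.erase i, orderSign (x i) (x j) := by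
      have h3 : Finset.univ.erase i = Finset.univ.map (Fin.succAboveEmb i) := by
        ext j
        simp only [Finset.mem_erase, Finset.mem_univ, and_true, Finset.mem_map, true_and,
          Fin.succAboveEmb_apply]
        exact Fin.exists_succAbove_eq_iff.symm
      rw [h3, Finset.prod_map]
      rfl
    have h4 : (∏ j ∈ Finset.univ.erase i, orderSign (x i) (x j)) *
        (∏ j ∈ Finset.univ.erase i, orderSign (x i) (x j)) = 1 := by
      rw [← Finset.prod_mul_distrib]
      refine Finset.prod_eq_one fun j hj => orderSign_mul_self fun h => ?_
      exact (Finset.mem_erase.1 hj).1 (hx h).symm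
    rw [h1, h2]
    linear_combination (orderSign y (x i) * (-1) ^ (i : ℕ) * signProd (i.removeNth x)) * h4
  · rw [signProd_cons, signProd_eq_zero hx, mul_zero, mul_zero, zero_add]
    simp only [Function.Injective, not_forall] at hx
    obtain ⟨a, b, hab, hne⟩ := hx
    -- An entry z above all others has only positive signs, so putting it in slot i represents the
    -- minor that omits i. With x a = x b, only the minors i = a and i = b can survive, and a
    -- transposition shows that they cancel.
    obtain ⟨z, hz⟩ : ∃ z, ∀ i, x i < z := by
      obtain ⟨M, hM⟩ := (Set.finite_range x).bddAbove
      exact ⟨M + 1, fun i => Nat.lt_succ_of_le (hM ⟨i, rfl⟩)⟩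
    have hrem : ∀ i : Fin (m + 1), (-1) ^ (i : ℕ) * signProd (i.removeNth x)
        = signProd (Function.update x i z) := by
      intro i
      rw [← hins, signProd_insertNth, Finset.prod_eq_one, mul_one]
      exact fun j _ => orderSign_of_lt (hz _)
    have hswap : Function.update x b z = Function.update x a z ∘ Equiv.swap a b := by
      funext i
      simp only [Function.comp, Equiv.swap_apply_def, Function.update_apply]
      split_ifs <;> simp_all
    have hzero : ∀ i, i ≠ a → i ≠ b → signProd (Function.update x i z) = 0 := by
      intro i hia hib
      refine signProd_eq_zero fun h => hne (h ?_)
      rw [Function.update_of_ne (Ne.symm hia), Function.update_of_ne (Ne.symm hib), hab]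
    have h5 : signProd (Function.update x b z) = -signProd (Function.update x a z) := by
      rw [hswap, signProd_comp_perm, Equiv.Perm.sign_swap hne]
      simp
    symm
    rw [Finset.sum_congr rfl (g := fun i => orderSign y (x i) * signProd (Function.update x i z))
      (fun i _ => by rw [← hrem]; ring)]
    rw [Fintype.sum_eq_add a b hne (fun i hi => by rw [hzero i hi.1 hi.2, mul_zero]), h5, hab]
    ring

/-! ### Alternating sums and their Pfaffian expansion -/

/-- The alternating sum `∑ signProd x * ∏ g i (x i)` over all tuples of natural numbers. -/
noncomputable def altSum {p : ℕ} (g : Fin p → ℕ → ℝ) : ℝ :=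
  ∑' x : Fin p → ℕ, signProd x * ∏ i, g i (x i)

/-- The antisymmetric pairing `∑ sign (y - x) * h y * f x`. -/
noncomputable def pairSum (h f : ℕ → ℝ) : ℝ :=
  ∑' z : ℕ × ℕ, orderSign z.1 z.2 * (h z.1 * f z.2)

lemma summable_prod_apply {p : ℕ} {g : Fin p → ℕ → ℝ} (hg : ∀ i, Summable (g i)) :
    Summable fun x : Fin p → ℕ => ∏ i, g i (x i) := by
  induction p with
  | zero => exact (hasSum_fintype _).summable
  | succ p ih =>
    rw [← (Fin.consEquiv fun _ => ℕ).summable_iff]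
    have h1 := ih (g := fun i => g i.succ) (fun i => hg _)
    have h2 := summable_mul_of_summable_norm (hg 0).norm h1.norm
    refine h2.congr fun z => ?_
    simp [Fin.prod_univ_succ, Fin.consEquiv]

lemma Summable.bdd_mul_real {ι : Type*} {c f : ι → ℝ} (hf : Summable f) (hc : ∀ i, |c i| ≤ 1) :
    Summable fun i => c i * f i := by
  refine Summable.of_norm_bounded hf.norm fun i => ?_
  rw [norm_mul]
  exact mul_le_of_le_one_left (norm_nonneg _) (hc i)

lemma summable_altSum {p : ℕ} {g : Fin p → ℕ → ℝ} (hg : ∀ i, Summable (g i)) :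
    Summable fun x : Fin p → ℕ => signProd x * ∏ i, g i (x i) :=
  (summable_prod_apply hg).bdd_mul_real abs_signProd_le

lemma summable_pairSum {h f : ℕ → ℝ} (hh : Summable h) (hf : Summable f) :
    Summable fun z : ℕ × ℕ => orderSign z.1 z.2 * (h z.1 * f z.2) :=
  (summable_mul_of_summable_norm hh.norm hf.norm).bdd_mul_real fun _ => abs_orderSign_le _ _

lemma altSum_zero (g : Fin 0 → ℕ → ℝ) : altSum g = 1 := by
  simp [altSum, signProd]

lemma altSum_one (h : ℕ → ℝ) (g : Fin 0 → ℕ → ℝ) :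
    altSum (Fin.cons h g : Fin 1 → ℕ → ℝ) = ∑' k, h k := by
  unfold altSum
  rw [← (Equiv.funUnique (Fin 1) ℕ).symm.tsum_eq]
  simp [signProd]

lemma altSum_comp_perm {p : ℕ} (g : Fin p → ℕ → ℝ) (σ : Equiv.Perm (Fin p)) :
    altSum (g ∘ σ) = ((Equiv.Perm.sign σ : ℤ) : ℝ) * altSum g := by
  unfold altSum
  rw [← (Equiv.arrowCongr σ.symm (Equiv.refl ℕ)).tsum_eq, ← tsum_mul_left]
  refine tsum_congr fun x => ?_
  have h1 : (Equiv.arrowCongr σ.symm (Equiv.refl ℕ)) x = x ∘ σ := rfl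
  rw [h1, signProd_comp_perm, mul_assoc]
  congr 2
  exact Equiv.prod_comp σ fun i => g i (x i)

lemma altSum_update_add {p : ℕ} {g : Fin p → ℕ → ℝ} (hg : ∀ i, Summable (g i)) (i : Fin p)
    {f₁ f₂ : ℕ → ℝ} (h₁ : Summable f₁) (h₂ : Summable f₂) :
    altSum (Function.update g i (f₁ + f₂)) =
      altSum (Function.update g i f₁) + altSum (Function.update g i f₂) := by
  have key : ∀ f : ℕ → ℝ, Summable f → ∀ j, Summable (Function.update g i f j) := by
    intro f hf j
    rcases eq_or_ne j i with rfl | hj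
    · simpa using hf
    · simpa [hj] using hg j
  unfold altSum
  rw [← (summable_altSum (key _ h₁)).tsum_add (summable_altSum (key _ h₂))]
  refine tsum_congr fun x => ?_
  have hp : ∀ f : ℕ → ℝ, ∏ j, Function.update g i f j (x j)
      = f (x i) * ∏ j ∈ Finset.univ.erase i, g j (x j) := by
    intro f
    rw [← Finset.mul_prod_erase _ _ (Finset.mem_univ i), Function.update_self]
    congr 1
    refine Finset.prod_congr rfl fun j hj => ?_
    rw [Function.update_of_ne (Finset.mem_erase.1 hj).1]
  rw [hp, hp, hp, Pi.add_apply]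
  ring

lemma altSum_update_smul {p : ℕ} (g : Fin p → ℕ → ℝ) (i : Fin p) (c : ℚ) (f : ℕ → ℝ) :
    altSum (Function.update g i (c • f)) = c • altSum (Function.update g i f) := by
  unfold altSum
  rw [Rat.smul_def, ← tsum_mul_left]
  refine tsum_congr fun x => ?_
  have hp : ∀ f : ℕ → ℝ, ∏ j, Function.update g i f j (x j)
      = f (x i) * ∏ j ∈ Finset.univ.erase i, g j (x j) := by
    intro f
    rw [← Finset.mul_prod_erase _ _ (Finset.mem_univ i), Function.update_self]
    congr 1
    refine Finset.prod_congr rfl fun j hj => ?_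
    rw [Function.update_of_ne (Finset.mem_erase.1 hj).1]
  rw [hp, hp, Pi.smul_apply, Rat.smul_def]
  ring

/-- Pfaffian-type expansion of an alternating sum along its first function. -/
lemma altSum_cons {m : ℕ} {h : ℕ → ℝ} {g : Fin (m + 1) → ℕ → ℝ} (hh : Summable h)
    (hg : ∀ i, Summable (g i)) :
    altSum (Fin.cons h g : Fin (m + 2) → ℕ → ℝ) =
      (if Even (m + 1) then 1 else 0) * ((∑' k, h k) * altSum g) +
        ∑ i : Fin (m + 1), (-1) ^ (i : ℕ) * (pairSum h (g i) * altSum (i.removeNth g)) := by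
  have hS := summable_altSum hg
  have hP := fun i => summable_pairSum hh (hg i)
  have hR : ∀ i : Fin (m + 1), Summable fun x : Fin m → ℕ =>
      signProd x * ∏ j, i.removeNth g j (x j) := fun i => summable_altSum fun j => hg _
  -- The i-th term of the expansion; it separates into a factor in (y, x i) and a factor in the
  -- remaining entries.
  let T : Fin (m + 1) → ℕ × (Fin (m + 1) → ℕ) → ℝ := fun i z =>
    (orderSign z.1 (z.2 i) * (h z.1 * g i (z.2 i))) *
      (signProd (i.removeNth z.2) * ∏ j, i.removeNth g j (i.removeNth z.2 j))
  let e : Fin (m + 1) → (ℕ × ℕ) × (Fin m → ℕ) ≃ ℕ × (Fin (m + 1) → ℕ) := fun i =>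
    (Equiv.prodAssoc ℕ ℕ (Fin m → ℕ)).trans
      (Equiv.prodCongr (Equiv.refl ℕ) (Fin.insertNthEquiv (fun _ => ℕ) i))
  have hTe : ∀ i z, T i (e i z) = (orderSign z.1.1 z.1.2 * (h z.1.1 * g i z.1.2)) *
      (signProd z.2 * ∏ j, i.removeNth g j (z.2 j)) := by
    intro i z
    have h1 : (e i z).2 = i.insertNth z.1.2 z.2 := rfl
    have h2 : (e i z).1 = z.1.1 := rfl
    simp only [T, h1, h2, Fin.insertNth_apply_same, Fin.removeNth_insertNth]
  have hTs : ∀ i, Summable (T i) := by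
    intro i
    rw [← (e i).summable_iff]
    exact (summable_mul_of_summable_norm (hP i).norm (hR i).norm).congr fun z => (hTe i z).symm
  have hTsum : ∀ i, ∑' z, T i z = pairSum h (g i) * altSum (i.removeNth g) := by
    intro i
    rw [← (e i).tsum_eq, pairSum, altSum,
      tsum_mul_tsum_of_summable_norm (hP i).norm (hR i).norm]
    exact tsum_congr fun z => hTe i z
  have hmain := summable_mul_of_summable_norm hh.norm hS.norm
  have hcongr : ∀ z : ℕ × (Fin (m + 1) → ℕ),
      signProd (Fin.consEquiv (fun _ => ℕ) z) *
        ∏ i, (Fin.cons h g : Fin (m + 2) → ℕ → ℝ) i (Fin.consEquiv (fun _ => ℕ) z i) =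
      (if Even (m + 1) then 1 else 0) * (h z.1 * (signProd z.2 * ∏ i, g i (z.2 i))) +
        ∑ i : Fin (m + 1), (-1) ^ (i : ℕ) * T i z := by
    intro z
    have h1 : ∀ i : Fin (m + 1), g i (z.2 i) * ∏ j, i.removeNth g j (i.removeNth z.2 j)
        = ∏ i, g i (z.2 i) := fun i => by
      rw [Fin.prod_univ_succAbove _ i]; rfl
    have h2 : signProd (Fin.consEquiv (fun _ => ℕ) z)
        = signProd (Fin.cons z.1 z.2 : Fin (m + 2) → ℕ) := rfl
    have h3 : ∏ i, (Fin.cons h g : Fin (m + 2) → ℕ → ℝ) i (Fin.consEquiv (fun _ => ℕ) z i)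
        = h z.1 * ∏ i, g i (z.2 i) := by
      rw [Fin.prod_univ_succ]; rfl
    rw [h2, h3, signProd_cons_eq, add_mul, Finset.sum_mul]
    congr 1
    · ring
    · refine Finset.sum_congr rfl fun i _ => ?_
      rw [← h1 i]
      simp only [T]
      ring
  rw [altSum, ← (Fin.consEquiv fun _ => ℕ).tsum_eq, tsum_congr hcongr,
    (hmain.mul_left _).tsum_add (summable_sum fun i _ => (hTs i).mul_left _),
    Summable.tsum_finsetSum fun i _ => (hTs i).mul_left _, tsum_mul_left,
    ← tsum_mul_tsum_of_summable_norm hh.norm hS.norm]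
  simp only [tsum_mul_left, hTsum]
  rfl

/-! ### Sorting and shifting tuples -/

/-- A sum over all tuples of a function vanishing on non-injective ones, arranged by sorting. -/
lemma sum_eq_sum_perm_strictAnti {p : ℕ} {f : (Fin p → ℕ) → ℝ} (hf : Summable f)
    (h0 : ∀ x, ¬ Function.Injective x → f x = 0) :
    ∑' x, f x = ∑ σ : Equiv.Perm (Fin p), ∑' x : {x : Fin p → ℕ // StrictAnti x}, f (x.1 ∘ σ) := by
  let φ : Equiv.Perm (Fin p) × {x : Fin p → ℕ // StrictAnti x} → (Fin p → ℕ) :=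
    fun z => z.2.1 ∘ z.1
  have hinj : Function.Injective φ := by
    rintro ⟨σ, x, hx⟩ ⟨τ, y, hy⟩ h
    simp only [φ] at h
    have hr : Set.range x = Set.range y := by
      have := congrArg Set.range h
      rwa [Set.range_comp, Set.range_comp, σ.surjective.range_eq, τ.surjective.range_eq,
        Set.image_univ, Set.image_univ] at this
    have hxy : x = y := by
      have h1 : StrictMono (OrderDual.toDual ∘ x) := hx.dual_right
      have h2 : StrictMono (OrderDual.toDual ∘ y) := hy.dual_right
      have := (StrictMono.range_inj h1 h2).1 (by rw [Set.range_comp, Set.range_comp, hr])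
      exact OrderDual.toDual.injective.comp_left this
    subst hxy
    have : σ = τ := Equiv.ext fun i => hx.injective (congrFun h i)
    subst this
    rfl
  have hsupp : Function.support f ⊆ Set.range φ := by
    intro x hx
    have hxi : Function.Injective x := by
      by_contra h
      exact hx (h0 x h)
    -- Sorting increasingly in the dual order makes the tuple decreasing.
    let y : Fin p → ℕᵒᵈ := OrderDual.toDual ∘ x
    have hm : StrictMono (y ∘ Tuple.sort y) :=
      (Tuple.monotone_sort y).strictMono_of_injective
        ((OrderDual.toDual.injective.comp hxi).comp (Tuple.sort y).injective)
    refine ⟨⟨(Tuple.sort y)⁻¹, ⟨x ∘ Tuple.sort y, fun a b hab => hm hab⟩⟩, ?_⟩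
    funext i
    simp [φ]
  have hs : Summable (f ∘ φ) := hf.comp_injective hinj
  rw [← hinj.tsum_eq hsupp]
  change ∑' z, (f ∘ φ) z = _
  rw [hs.tsum_prod, tsum_fintype]
  rfl

/-- Alternating sums are unchanged when the functions are moved `N` places to the right. -/
lemma altSum_shift {p : ℕ} (N : ℕ) (g : Fin p → ℕ → ℝ) (hg : ∀ i, ∀ k < N, g i k = 0) :
    altSum (fun i k => g i (N + k)) = altSum g := by
  have hinj : Function.Injective fun (x : Fin p → ℕ) i => N + x i := by
    intro x y h
    funext i
    have := congrFun h i
    simpa using this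
  unfold altSum
  rw [← hinj.tsum_eq (f := fun x => signProd x * ∏ i, g i (x i))]
  · refine tsum_congr fun x => ?_
    congr 1
    simp [signProd, orderSign]
  · intro x hx
    refine ⟨fun i => x i - N, funext fun i => ?_⟩
    have : N ≤ x i := by
      by_contra h
      exact hx (mul_eq_zero_of_right _
        (Finset.prod_eq_zero (Finset.mem_univ i) (hg i _ (not_le.1 h))))
    simp only
    omega

/-! ### Zeta values and reduction to generators -/

/-- The function `k ↦ 1 / (k + 1) ^ s`, whose sum is the zeta value at `s`. -/
noncomputable def zetaFun (s k : ℕ) : ℝ := 1 / ((k : ℝ) + 1) ^ s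

lemma summable_zetaFun {s : ℕ} (hs : 2 ≤ s) : Summable (zetaFun s) := by
  have := (summable_nat_add_iff 1).2 (Real.summable_one_div_nat_pow.2 hs)
  exact this.congr fun k => by simp [zetaFun]

/-- The rational span of `1` and of the zeta values at odd integers from `3` to `B`. -/
noncomputable def oddZetaSpan (B : ℕ) : Submodule ℚ ℝ :=
  Submodule.span ℚ ({1} ∪ {x | ∃ s, Odd s ∧ 3 ≤ s ∧ s ≤ B ∧ x = multiZeta ![s]})

/-- Tuples in `k ≥ 1` correspond to tuples in `ℕ` by subtracting one from each entry. -/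
noncomputable def strictAntiEquiv (p : ℕ) :
    {x : Fin p → ℕ // StrictAnti x} ≃ {k : Fin p → ℕ // StrictAnti k ∧ ∀ i, 1 ≤ k i} where
  toFun x := ⟨fun i => x.1 i + 1, fun a b h => Nat.succ_lt_succ (x.2 h), fun _ => Nat.le_add_left 1 _⟩
  invFun k := ⟨fun i => k.1 i - 1, fun a b h => by
    have := k.2.1 h
    have := k.2.2 b
    show k.1 b - 1 < k.1 a - 1
    omega⟩
  left_inv x := by ext; simp
  right_inv k := by
    ext i
    exact Nat.sub_add_cancel (k.2.2 i)

lemma multiZeta_eq {p : ℕ} (s : Fin p → ℕ) :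
    multiZeta s = ∑' x : {x : Fin p → ℕ // StrictAnti x}, ∏ i, zetaFun (s i) (x.1 i) := by
  unfold multiZeta
  rw [← (strictAntiEquiv p).tsum_eq]
  refine tsum_congr fun x => Finset.prod_congr rfl fun i _ => ?_
  simp [strictAntiEquiv, zetaFun]

lemma multiZeta_singleton (s : ℕ) : multiZeta ![s] = ∑' k, zetaFun s k := by
  let e : ℕ ≃ {x : Fin 1 → ℕ // StrictAnti x} :=
    (Equiv.funUnique (Fin 1) ℕ).symm.trans
      (Equiv.subtypeUnivEquiv fun x => Subsingleton.strictAnti x).symm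
  rw [multiZeta_eq, ← e.tsum_eq]
  refine tsum_congr fun k => ?_
  simp [e]

lemma altSum_zetaFun {p : ℕ} {s : Fin p → ℕ} (hs : ∀ i, 2 ≤ s i) :
    altSum (fun i => zetaFun (s i)) = antisymZeta s := by
  have hsum := summable_altSum fun i => summable_zetaFun (hs i)
  unfold altSum antisymZeta
  -- Permuting the entries of x by σ amounts to permuting the exponents by σ⁻¹, hence the reindexing
  -- by inversion.
  rw [sum_eq_sum_perm_strictAnti hsum fun x hx => by rw [signProd_eq_zero hx, zero_mul],
    ← Equiv.sum_comp (Equiv.inv (Equiv.Perm (Fin p)))]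
  refine Finset.sum_congr rfl fun σ _ => ?_
  rw [multiZeta_eq, ← tsum_mul_left]
  refine tsum_congr fun x => ?_
  rw [signProd_comp_perm, signProd_of_strictAnti x.2]
  simp only [Equiv.inv_apply, Equiv.Perm.sign_inv, mul_one]
  congr 1
  rw [← Equiv.prod_comp σ]
  simp

lemma one_mem_zetaProducts (A p : ℕ) : (1 : ℝ) ∈ zetaProducts A p := by
  refine ⟨0, 0, ![], ![], by omega, fun i => i.elim0, fun i => i.elim0, ?_⟩
  rw [← altSum_zetaFun fun i => i.elim0, altSum_zero]
  simp

lemma antisymZeta_mem_zetaProducts {A p : ℕ} {s : Fin p → ℕ}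
    (hs : ∀ i, Odd (s i) ∧ 3 ≤ s i ∧ s i ≤ A) : antisymZeta s ∈ zetaProducts A p :=
  ⟨0, p, ![], s, by omega, fun i => i.elim0, hs, by simp⟩

lemma zetaProducts_mono (A : ℕ) {p p' : ℕ} (h : p ≤ p') :
    zetaProducts A p ⊆ zetaProducts A p' := by
  rintro x ⟨q, q', s, s', h1, h2⟩
  exact ⟨q, q', s, s', h1.trans h, h2⟩

/-- A further depth-one factor raises q by one and so 2q + q' by two; the generator 1 costs nothing.
-/
lemma oddZetaSpan_mul_mem {A p : ℕ} {z w : ℝ} (hz : z ∈ oddZetaSpan (2 * A - 1))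
    (hw : w ∈ Submodule.span ℚ (zetaProducts A p)) :
    z * w ∈ Submodule.span ℚ (zetaProducts A (p + 2)) := by
  have h := Submodule.mul_mem_mul hz hw
  rw [oddZetaSpan, Submodule.span_mul_span] at h
  refine Submodule.span_mono ?_ h
  rintro _ ⟨a, ha, b, hb, rfl⟩
  rcases ha with rfl | ⟨s, hs1, hs2, hs3, rfl⟩
  · simpa using zetaProducts_mono A (by omega) hb
  · obtain ⟨q, q', t, t', h1, h2, h3, rfl⟩ := hb
    refine ⟨q + 1, q', Fin.cons s t, t', by omega, ?_, h3, ?_⟩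
    · intro i
      refine Fin.cases ?_ (fun i => ?_) i
      · exact ⟨hs1, hs2, hs3⟩
      · simpa using h2 i
    · simp [Fin.prod_univ_succ, mul_assoc]

/-- Strong induction on p. Any generator that is not a zeta function is expanded away: its total
contributes a rational factor, and its pairings contribute odd zeta values at the cost of two
functions. -/
lemma altSum_mem_of_generators {A : ℕ} {G : Set (ℕ → ℝ)} (hG : ∀ g ∈ G, Summable g)
    (hG' : ∀ g ∈ G, (∃ s, (Odd s ∧ 3 ≤ s ∧ s ≤ A) ∧ g = zetaFun s) ∨
      ((∃ q : ℚ, ∑' k, g k = q) ∧ ∀ f ∈ G, pairSum g f ∈ oddZetaSpan (2 * A - 1)))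
    (p : ℕ) : ∀ g : Fin p → ℕ → ℝ, (∀ i, g i ∈ G) →
      altSum g ∈ Submodule.span ℚ (zetaProducts A p) := by
  induction p using Nat.strong_induction_on with
  | _ p ih =>
    intro g hg
    by_cases hz : ∀ i, ∃ s, (Odd s ∧ 3 ≤ s ∧ s ≤ A) ∧ g i = zetaFun s
    · choose s hs hgs using hz
      have : g = fun i => zetaFun (s i) := funext hgs
      rw [this, altSum_zetaFun fun i => by have := (hs i).2.1; omega]
      exact Submodule.subset_span (antisymZeta_mem_zetaProducts hs)
    · push Not at hz
      obtain ⟨i, hi⟩ := hz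
      obtain ⟨⟨q, hq⟩, hpair⟩ := (hG' _ (hg i)).resolve_left fun ⟨s, hs, h⟩ => hi s hs h
      obtain _ | m := p
      · exact i.elim0
      -- Bring the non-zeta generator to the front, which changes the alternating sum only by a
      -- sign.
      have hperm : g = (Fin.cons (g i) (i.removeNth g) : Fin (m + 1) → ℕ → ℝ) ∘ i.cycleRange := by
        rw [Fin.cons_comp_cycleRange, Fin.insertNth_self_removeNth]
      rw [hperm, altSum_comp_perm]
      have key : altSum (Fin.cons (g i) (i.removeNth g) : Fin (m + 1) → ℕ → ℝ) ∈
          Submodule.span ℚ (zetaProducts A (m + 1)) := by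
        have hrat : ∀ (c : ℚ) (w : ℝ) (p' : ℕ), p' ≤ m + 1 →
            w ∈ Submodule.span ℚ (zetaProducts A p') →
            (c : ℝ) * w ∈ Submodule.span ℚ (zetaProducts A (m + 1)) := by
          intro c w p' hp' hw
          rw [← Rat.smul_def]
          exact Submodule.smul_mem _ _ (Submodule.span_mono (zetaProducts_mono A hp') hw)
        obtain _ | m := m
        · rw [altSum_one, hq]
          simpa using hrat q 1 0 (by omega) (Submodule.subset_span (one_mem_zetaProducts A 0))
        · have hrem : ∀ j, i.removeNth g j ∈ G := fun j => hg _
          rw [altSum_cons (hG _ (hg i)) fun j => hG _ (hrem j), hq]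
          refine Submodule.add_mem _ ?_ (Submodule.sum_mem _ fun j _ => ?_)
          · have := hrat ((if Even (m + 1) then 1 else 0) * q) _ (m + 1) (by omega)
              (ih (m + 1) (by omega) _ hrem)
            split_ifs at this ⊢
            · rwa [one_mul] at this ⊢
            · simp
          · have := hrat ((-1) ^ (j : ℕ)) _ (m + 2) le_rfl
              (oddZetaSpan_mul_mem (hpair _ (hrem j))
                (ih m (by omega) (j.removeNth (i.removeNth g)) fun l => hrem _))
            push_cast at this
            exact this
      have h2 := Submodule.smul_mem _ ((Equiv.Perm.sign i.cycleRange : ℤ) : ℚ) key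
      rw [Rat.smul_def] at h2
      simpa using h2

lemma summable_of_mem_span {G : Set (ℕ → ℝ)} (hG : ∀ g ∈ G, Summable g) {g : ℕ → ℝ}
    (hg : g ∈ Submodule.span ℚ G) : Summable g := by
  induction hg using Submodule.span_induction with
  | mem g h => exact hG g h
  | zero => exact summable_zero
  | add f g _ _ hf hg => exact hf.add hg
  | smul c f _ hf => exact (hf.mul_left (c : ℝ)).congr fun k => by simp [Rat.smul_def]

/-- Multilinearity, one slot at a time: s is the set of slots already allowed to range over the
span. -/
lemma altSum_mem_of_span {G : Set (ℕ → ℝ)} (hG : ∀ g ∈ G, Summable g) {p : ℕ}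
    {W : Submodule ℚ ℝ} (hW : ∀ g : Fin p → ℕ → ℝ, (∀ i, g i ∈ G) → altSum g ∈ W)
    (g : Fin p → ℕ → ℝ) (hg : ∀ i, g i ∈ Submodule.span ℚ G) : altSum g ∈ W := by
  suffices h : ∀ (s : Finset (Fin p)) (g : Fin p → ℕ → ℝ),
      (∀ i ∈ s, g i ∈ Submodule.span ℚ G) → (∀ i ∉ s, g i ∈ G) → altSum g ∈ W from
    h Finset.univ g (fun i _ => hg i) fun i hi => absurd (Finset.mem_univ i) hi
  intro s
  induction s using Finset.induction_on with
  | empty => exact fun g _ h => hW g fun i => h i (Finset.notMem_empty i)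
  | insert a s ha ih =>
    intro g h1 h2
    have hsum : ∀ i, Summable (g i) := fun i => by
      by_cases hi : i ∈ insert a s
      · exact summable_of_mem_span hG (h1 i hi)
      · exact hG _ (h2 i hi)
    have key : ∀ f ∈ Submodule.span ℚ G, altSum (Function.update g a f) ∈ W := by
      intro f hf
      induction hf using Submodule.span_induction with
      | mem f hf =>
        refine ih _ (fun i hi => ?_) fun i hi => ?_
        · have : i ≠ a := fun h => ha (h ▸ hi)
          rw [Function.update_of_ne this]
          exact h1 i (Finset.mem_insert_of_mem hi)
        · rcases eq_or_ne i a with rfl | hia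
          · simpa using hf
          · rw [Function.update_of_ne hia]
            exact h2 i (by simp [hia, hi])
      | zero =>
        have := altSum_update_smul g a 0 0
        rw [zero_smul, zero_smul] at this
        rw [this]
        exact W.zero_mem
      | add f₁ f₂ hf₁ hf₂ i₁ i₂ =>
        rw [altSum_update_add hsum a (summable_of_mem_span hG hf₁) (summable_of_mem_span hG hf₂)]
        exact W.add_mem i₁ i₂
      | smul c f _ i =>
        rw [altSum_update_smul]
        exact W.smul_mem c i
    simpa using key (g a) (h1 a (Finset.mem_insert_self a s))

/-! ### Rational functions with poles in [-N, N] and partial fractions -/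

open Polynomial in
/-- The polynomial with simple zeros at the integers `j` with `|j| ≤ N`. -/
noncomputable def centralPoly (N : ℕ) : ℚ[X] := ∏ j ∈ Finset.Icc (-N : ℤ) N, (X - C (j : ℚ))

open Polynomial in
/-- Outside `[-N, N]` the function is `Q / centralPoly N ^ B` with `Q` of degree less than `e`. -/
def IsCentralRat (N B e : ℕ) (f : ℤ → ℝ) : Prop :=
  ∃ Q : ℚ[X], Q.degree < e ∧
    ∀ x : ℤ, (N : ℤ) < |x| → f x = aeval (x : ℝ) Q / (aeval (x : ℝ) (centralPoly N)) ^ B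

section
open Polynomial

lemma centralPoly_monic (N : ℕ) : (centralPoly N).Monic :=
  monic_prod_of_monic _ _ fun _ _ => monic_X_sub_C _

lemma natDegree_centralPoly (N : ℕ) : (centralPoly N).natDegree = 2 * N + 1 := by
  rw [centralPoly, natDegree_prod_of_monic _ _ fun _ _ => monic_X_sub_C _]
  simp only [natDegree_X_sub_C, Finset.sum_const, Int.card_Icc, smul_eq_mul, mul_one]
  omega

lemma aeval_centralPoly (N : ℕ) (x : ℝ) :
    aeval x (centralPoly N) = ∏ j ∈ Finset.Icc (-N : ℤ) N, (x - j) := by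
  simp [centralPoly, map_prod]

lemma int_sub_ne_zero {N : ℕ} {x j : ℤ} (hx : (N : ℤ) < |x|) (hj : j ∈ Finset.Icc (-N : ℤ) N) :
    (x : ℝ) - j ≠ 0 := by
  rw [Finset.mem_Icc] at hj
  rw [sub_ne_zero]
  intro h
  have h' : x = j := by exact_mod_cast h
  subst h'
  exact absurd (abs_le.2 hj) (not_le.2 hx)

lemma aeval_centralPoly_ne_zero {N : ℕ} {x : ℤ} (hx : (N : ℤ) < |x|) :
    aeval (x : ℝ) (centralPoly N) ≠ 0 := by
  rw [aeval_centralPoly]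
  exact Finset.prod_ne_zero_iff.2 fun j hj => int_sub_ne_zero hx hj

lemma IsCentralRat.add {N B e : ℕ} {f g : ℤ → ℝ} (hf : IsCentralRat N B e f)
    (hg : IsCentralRat N B e g) : IsCentralRat N B e fun x => f x + g x := by
  obtain ⟨Q, hQ, hf⟩ := hf
  obtain ⟨R, hR, hg⟩ := hg
  refine ⟨Q + R, (degree_add_le _ _).trans_lt (max_lt hQ hR), fun x hx => ?_⟩
  simp only [hf x hx, hg x hx, map_add, add_div]

lemma IsCentralRat.const_mul {N B e : ℕ} {f : ℤ → ℝ} (hf : IsCentralRat N B e f) (c : ℚ) :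
    IsCentralRat N B e fun x => c * f x := by
  obtain ⟨Q, hQ, hf⟩ := hf
  refine ⟨c • Q, (degree_smul_le _ _).trans_lt hQ, fun x hx => ?_⟩
  simp only [hf x hx, map_smul, Rat.smul_def, mul_div_assoc]

lemma IsCentralRat.mul {N B B' e e' : ℕ} {f g : ℤ → ℝ} (hf : IsCentralRat N B e f)
    (hg : IsCentralRat N B' e' g) :
    IsCentralRat N (B + B') (e + e' - 1) fun x => f x * g x := by
  obtain ⟨Q, hQ, hf⟩ := hf
  obtain ⟨R, hR, hg⟩ := hg
  refine ⟨Q * R, ?_, fun x hx => ?_⟩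
  · by_cases h : Q * R = 0
    · rw [h, degree_zero]; exact WithBot.bot_lt_coe _
    · have h1 : Q ≠ 0 := left_ne_zero_of_mul h
      have h2 : R ≠ 0 := right_ne_zero_of_mul h
      rw [← natDegree_lt_iff_degree_lt h, natDegree_mul h1 h2]
      rw [← natDegree_lt_iff_degree_lt h1] at hQ
      rw [← natDegree_lt_iff_degree_lt h2] at hR
      omega
  · simp only [hf x hx, hg x hx, map_mul, pow_add, div_mul_div_comm]

lemma isCentralRat_inv_pow {N B s : ℕ} {j : ℤ} (hj : j ∈ Finset.Icc (-N : ℤ) N) (hs : 1 ≤ s)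
    (hsB : s ≤ B) : IsCentralRat N B (B * (2 * N + 1)) fun x => 1 / ((x : ℝ) - j) ^ s := by
  have hprod : centralPoly N
      = (X - C (j : ℚ)) * ∏ k ∈ (Finset.Icc (-N : ℤ) N).erase j, (X - C (k : ℚ)) :=
    (Finset.mul_prod_erase _ _ hj).symm
  set R := ∏ k ∈ (Finset.Icc (-N : ℤ) N).erase j, (X - C (k : ℚ)) with hR
  have hRm : R.Monic := monic_prod_of_monic _ _ fun _ _ => monic_X_sub_C _
  have hdeg : R.natDegree + 1 = 2 * N + 1 := by
    rw [← natDegree_centralPoly, hprod, (monic_X_sub_C _).natDegree_mul hRm, natDegree_X_sub_C,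
      add_comm]
  refine ⟨R ^ s * centralPoly N ^ (B - s), ?_, fun x hx => ?_⟩
  · have hm : (R ^ s * centralPoly N ^ (B - s)).Monic := (hRm.pow _).mul ((centralPoly_monic N).pow _)
    rw [← natDegree_lt_iff_degree_lt hm.ne_zero, (hRm.pow _).natDegree_mul
      ((centralPoly_monic N).pow _), hRm.natDegree_pow, (centralPoly_monic N).natDegree_pow,
      natDegree_centralPoly]
    obtain ⟨b, rfl⟩ := Nat.exists_eq_add_of_le hsB
    rw [Nat.add_sub_cancel_left, add_mul]
    have : s * R.natDegree < s * (2 * N + 1) := Nat.mul_lt_mul_of_pos_left (by omega) hs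
    omega
  · have h0 := aeval_centralPoly_ne_zero hx
    have h1 := int_sub_ne_zero hx hj
    have h2 : aeval (x : ℝ) (centralPoly N) = ((x : ℝ) - j) * aeval (x : ℝ) R := by
      rw [hprod, map_mul]; simp
    have h3 : aeval (x : ℝ) R ≠ 0 := by
      intro h
      rw [h2, h, mul_zero] at h0
      exact h0 rfl
    have h4 : aeval (x : ℝ) (centralPoly N) ^ B
        = aeval (x : ℝ) (centralPoly N) ^ s * aeval (x : ℝ) (centralPoly N) ^ (B - s) := by
      rw [← pow_add, Nat.add_sub_cancel' hsB]
    rw [h4, map_mul, map_pow, map_pow, mul_div_mul_right _ _ (pow_ne_zero _ h0), h2, mul_pow]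
    field_simp

/-- Partial fractions of a proper fraction with denominator `centralPoly N ^ B`; the residues add
up to zero when the fraction decreases at least quadratically. -/
lemma exists_partialFraction (N B : ℕ) (Q : ℚ[X]) (hQ : Q.degree < (B * (2 * N + 1) - 1 : ℕ)) :
    ∃ c : ℤ → ℕ → ℚ, (∑ j ∈ Finset.Icc (-N : ℤ) N, c j 0 = 0) ∧
      ∀ x : ℤ, (N : ℤ) < |x| →
        aeval (x : ℝ) Q / (aeval (x : ℝ) (centralPoly N)) ^ B =
          ∑ j ∈ Finset.Icc (-N : ℤ) N, ∑ l ∈ Finset.range B, c j l * (1 / ((x : ℝ) - j) ^ (l + 1)) := by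
  set I := Finset.Icc (-N : ℤ) N with hI
  rcases Nat.eq_zero_or_pos B with rfl | hB
  · refine ⟨0, by simp, fun x _ => ?_⟩
    have : Q = 0 := by
      rw [← degree_eq_bot]
      by_contra h
      rw [degree_eq_natDegree (by simpa using h)] at hQ
      simp at hQ
    simp [this]
  have hcop : Set.Pairwise (I : Set ℤ) fun i j =>
      IsCoprime (X - C (i : ℚ)) (X - C (j : ℚ)) := fun i _ j _ hij =>
    pairwise_coprime_X_sub_C (s := fun i : ℤ => (i : ℚ)) Int.cast_injective hij
  obtain ⟨q, r, hr, hfac⟩ := eq_quo_mul_prod_pow_add_sum_rem_mul_prod_pow Q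
    (g := fun j : ℤ => X - C (j : ℚ)) (s := I) (fun j _ => monic_X_sub_C _) hcop fun _ => B
  have hM : ∀ j ∈ I, ∀ l : ℕ,
      ((X - C (j : ℚ)) ^ l * ∏ k ∈ I.erase j, (X - C (k : ℚ)) ^ B).Monic ∧
      ((X - C (j : ℚ)) ^ l * ∏ k ∈ I.erase j, (X - C (k : ℚ)) ^ B).natDegree = l + 2 * N * B := by
    intro j hj l
    have h1 : (∏ k ∈ I.erase j, (X - C (k : ℚ)) ^ B).Monic :=
      monic_prod_of_monic _ _ fun _ _ => (monic_X_sub_C _).pow _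
    refine ⟨((monic_X_sub_C _).pow _).mul h1, ?_⟩
    rw [((monic_X_sub_C _).pow _).natDegree_mul h1,
      natDegree_prod_of_monic _ _ fun _ _ => (monic_X_sub_C _).pow _]
    simp only [(monic_X_sub_C _).natDegree_pow, natDegree_X_sub_C, mul_one, Finset.sum_const,
      Finset.card_erase_of_mem hj, smul_eq_mul]
    congr 2
    simp [hI]
    omega
  have hrC : ∀ j ∈ I, ∀ l, r j l = C ((r j l).coeff 0) := fun j hj l => by
    have := hr j hj l
    rw [degree_X_sub_C] at this
    exact eq_C_of_degree_le_zero (Nat.WithBot.lt_one_iff_le_zero.1 this)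
  have hPB : ∏ j ∈ I, (X - C (j : ℚ)) ^ B = centralPoly N ^ B := by
    rw [centralPoly, Finset.prod_pow]
  have hterm : ∀ j ∈ I, ∀ l : Fin B,
      r j l * (X - C (j : ℚ)) ^ l.1 * ∏ k ∈ I.erase j, (X - C (k : ℚ)) ^ B =
      C ((r j l).coeff 0) * ((X - C (j : ℚ)) ^ l.1 * ∏ k ∈ I.erase j, (X - C (k : ℚ)) ^ B) := by
    intro j hj l
    rw [← hrC j hj l, mul_assoc]
  rw [hPB, Finset.sum_congr rfl fun j hj => Finset.sum_congr rfl fun l _ => hterm j hj l] at hfac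
  set S := ∑ j ∈ I, ∑ l : Fin B, C ((r j l).coeff 0) *
    ((X - C (j : ℚ)) ^ l.1 * ∏ k ∈ I.erase j, (X - C (k : ℚ)) ^ B) with hS
  have hDdeg : (centralPoly N ^ B).degree = (B * (2 * N + 1) : ℕ) := by
    rw [degree_eq_natDegree ((centralPoly_monic N).pow _).ne_zero,
      (centralPoly_monic N).natDegree_pow, natDegree_centralPoly]
  have hSdeg : S.degree < (B * (2 * N + 1) : ℕ) := by
    rw [← mem_degreeLT]
    refine Submodule.sum_mem _ fun j hj => Submodule.sum_mem _ fun l _ => ?_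
    rw [← smul_eq_C_mul]
    refine Submodule.smul_mem _ _ (mem_degreeLT.2 ?_)
    rw [← natDegree_lt_iff_degree_lt (hM j hj l).1.ne_zero, (hM j hj l).2]
    have := l.2
    nlinarith
  have hQdeg : Q.degree < (B * (2 * N + 1) : ℕ) :=
    hQ.trans_le (by exact_mod_cast Nat.sub_le _ _)
  -- The difference is a multiple of `centralPoly N ^ B` of smaller degree, so there is no
  -- polynomial part.
  have hQS : Q - S = 0 := by
    by_contra hne
    refine ((centralPoly_monic N).pow B).not_dvd_of_degree_lt hne ?_ ⟨q, by rw [hfac]; ring⟩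
    rw [hDdeg]
    exact (degree_sub_le _ _).trans_lt (max_lt hQdeg hSdeg)
  rw [sub_eq_zero] at hQS
  let a : ℤ → ℕ → ℚ := fun j l => if h : l < B then (r j ⟨l, h⟩).coeff 0 else 0
  have ha : ∀ j (l : Fin B), (r j l).coeff 0 = a j l := fun j l => by simp [a]
  -- The numerator term with factor (X - j)^l gives a pole of order B - l, hence the reversed index.
  -- The simple poles come from l = B - 1, the only terms of degree B(2N + 1) - 1; that coefficient
  -- of Q vanishes, so the residues add up to zero.
  refine ⟨fun j l => a j (B - 1 - l), ?_, fun x hx => ?_⟩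
  · have h0 : Q.coeff (B * (2 * N + 1) - 1) = 0 := coeff_eq_zero_of_degree_lt hQ
    rw [hQS, hS, finsetSum_coeff] at h0
    rw [← h0]
    refine Finset.sum_congr rfl fun j hj => ?_
    rw [finsetSum_coeff, Finset.sum_eq_single (⟨B - 1, by omega⟩ : Fin B)]
    · have h1 : B * (2 * N + 1) - 1 = B - 1 + 2 * N * B := by
        have : B * (2 * N + 1) = 2 * N * B + B := by ring
        omega
      rw [coeff_C_mul, h1, ← (hM j hj (B - 1)).2]
      rw [coeff_natDegree, (hM j hj (B - 1)).1.leadingCoeff, mul_one, ha]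
      simp
    · intro l _ hl
      rw [coeff_C_mul]
      refine mul_eq_zero_of_right _ (coeff_eq_zero_of_natDegree_lt ?_)
      rw [(hM j hj l).2]
      have h1 : B * (2 * N + 1) = 2 * N * B + B := by ring
      have h2 : l.1 ≠ B - 1 := fun h => hl (Fin.ext h)
      have := l.2
      omega
    · simp
  · have hne := aeval_centralPoly_ne_zero hx
    rw [hQS, hS, map_sum, Finset.sum_div]
    refine Finset.sum_congr rfl fun j hj => ?_
    rw [map_sum, Finset.sum_div]
    have h1 := int_sub_ne_zero hx hj
    have h2 : aeval (x : ℝ) (centralPoly N) ^ B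
        = ((x : ℝ) - j) ^ B * ∏ k ∈ I.erase j, ((x : ℝ) - k) ^ B := by
      rw [aeval_centralPoly, ← Finset.mul_prod_erase _ _ hj, mul_pow, Finset.prod_pow]
    have h3 : ∏ k ∈ I.erase j, ((x : ℝ) - k) ^ B ≠ 0 :=
      Finset.prod_ne_zero_iff.2 fun k hk =>
        pow_ne_zero _ (int_sub_ne_zero hx (Finset.mem_of_mem_erase hk))
    have h4 : ∀ l : Fin B, aeval (x : ℝ) (C ((r j l).coeff 0) *
        ((X - C (j : ℚ)) ^ l.1 * ∏ k ∈ I.erase j, (X - C (k : ℚ)) ^ B)) /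
        aeval (x : ℝ) (centralPoly N) ^ B = a j l * (1 / ((x : ℝ) - j) ^ (B - 1 - l + 1)) := by
      intro l
      have h5 : ((x : ℝ) - j) ^ B = ((x : ℝ) - j) ^ l.1 * ((x : ℝ) - j) ^ (B - 1 - l + 1) := by
        rw [← pow_add]
        congr 1
        omega
      have h6 : aeval (x : ℝ) (C ((r j l).coeff 0) *
          ((X - C (j : ℚ)) ^ l.1 * ∏ k ∈ I.erase j, (X - C (k : ℚ)) ^ B))
          = a j l * (((x : ℝ) - j) ^ l.1 * ∏ k ∈ I.erase j, ((x : ℝ) - k) ^ B) := by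
        simp [ha, map_prod]
      rw [h6, h2, h5]
      field_simp
    rw [Finset.sum_congr rfl fun l _ => h4 l,
      Fin.sum_univ_eq_sum_range fun l => (a j l : ℝ) * (1 / ((x : ℝ) - j) ^ (B - 1 - l + 1)),
      ← Finset.sum_range_reflect]
    refine Finset.sum_congr rfl fun l hl => ?_
    rw [Finset.mem_range] at hl
    rw [show B - 1 - (B - 1 - l) = l by omega]

end

/-! ### Odd partial fractions and telescoping functions -/

/-- The even function whose difference is the difference of two consecutive odd partial
fractions. -/
noncomputable def telePrim (s i : ℕ) (x : ℤ) : ℝ :=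
  -(1 / ((x : ℝ) + 1 - i) ^ s + (-1) ^ s / ((x : ℝ) + i) ^ s)

/-- The odd part of the partial fraction `1 / (x - j) ^ s`. -/
noncomputable def oddFrac (s : ℕ) (j x : ℤ) : ℝ :=
  1 / ((x : ℝ) - j) ^ s - (-1) ^ s / ((x : ℝ) + j) ^ s

/-- Moving the poles of an odd fraction from ±i to ±(i + 1) costs a difference in x, so modulo
differences all poles can be moved to 0. -/
lemma telePrim_sub (s i : ℕ) (x : ℤ) :
    telePrim s (i + 1) x - telePrim s (i + 1) (x - 1) = oddFrac s (i + 1 : ℕ) x - oddFrac s i x := by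
  unfold telePrim oddFrac
  push_cast
  rw [show (x : ℝ) + 1 - (i + 1) = x - i by ring, show (x : ℝ) - 1 + 1 - (i + 1) = x - (i + 1) by ring,
    show (x : ℝ) - 1 + (i + 1) = x + i by ring]
  ring

lemma one_div_neg_pow (y : ℝ) (s : ℕ) : 1 / (-y) ^ s = (-1) ^ s / y ^ s := by
  rw [neg_pow, one_div, mul_inv, ← inv_pow, inv_neg, inv_one, div_eq_mul_inv]

lemma neg_one_pow_div_neg_pow (y : ℝ) (s : ℕ) : (-1) ^ s / (-y) ^ s = 1 / y ^ s := by
  rw [← one_div_neg_pow, neg_neg]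

/-- The telescoping odd functions, on the integers greater than `N`. -/
noncomputable def teleFun (N s i k : ℕ) : ℝ :=
  telePrim s i ((N : ℤ) + 1 + k) - telePrim s i ((N : ℤ) + k)

/-- The function `x ↦ 1 / x ^ s`, on the integers greater than `N`. -/
noncomputable def shiftedZetaFun (N s k : ℕ) : ℝ := zetaFun s (N + k)

/-- The rational span of the odd powers `1 / x ^ s` and of the telescoping odd functions, on the
integers greater than `N`, with poles of order at most `B`. -/
noncomputable def oddRatSpan (N B : ℕ) : Submodule ℚ (ℕ → ℝ) :=
  Submodule.span ℚ ({f | ∃ s, (Odd s ∧ 3 ≤ s ∧ s ≤ B) ∧ f = shiftedZetaFun N s} ∪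
    {f | ∃ s i, (1 ≤ s ∧ s ≤ B) ∧ (1 ≤ i ∧ i ≤ N) ∧ f = teleFun N s i})

lemma oddFrac_neg (s : ℕ) (j x : ℤ) : oddFrac s (-j) x = -(-1) ^ s * oddFrac s j x := by
  unfold oddFrac
  have h : ((-1 : ℝ) ^ s) * (-1) ^ s = 1 := by rw [← mul_pow]; simp
  push_cast
  rw [sub_neg_eq_add, ← sub_eq_add_neg]
  linear_combination (-(1 / ((x : ℝ) + j) ^ s)) * h

lemma oddFrac_zero (s : ℕ) (x : ℤ) : oddFrac s 0 x = (1 - (-1) ^ s) * (1 / (x : ℝ) ^ s) := by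
  unfold oddFrac
  simp
  ring

lemma oddFrac_sub_mem_of_nat {N B s : ℕ} (hs : 1 ≤ s) (hsB : s ≤ B) (j : ℕ) (hj : j ≤ N) :
    (fun k : ℕ => oddFrac s j ((N : ℤ) + 1 + k) - oddFrac s 0 ((N : ℤ) + 1 + k))
      ∈ oddRatSpan N B := by
  induction j with
  | zero => convert (oddRatSpan N B).zero_mem using 1; funext k; simp
  | succ j ih =>
    have h1 : teleFun N s (j + 1) ∈ oddRatSpan N B :=
      Submodule.subset_span (Or.inr ⟨s, j + 1, ⟨hs, hsB⟩, ⟨by omega, hj⟩, rfl⟩)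
    convert (oddRatSpan N B).add_mem (ih (by omega)) h1 using 1
    funext k
    have := telePrim_sub s j ((N : ℤ) + 1 + k)
    rw [show (N : ℤ) + 1 + k - 1 = N + k by ring] at this
    simp only [Pi.add_apply, teleFun, this]
    ring

lemma oddFrac_sub_mem {N B s : ℕ} (hs : 1 ≤ s) (hsB : s ≤ B) {j : ℤ}
    (hj : j ∈ Finset.Icc (-N : ℤ) N) :
    (fun k : ℕ => oddFrac s j ((N : ℤ) + 1 + k) - oddFrac s 0 ((N : ℤ) + 1 + k))
      ∈ oddRatSpan N B := by
  rw [Finset.mem_Icc] at hj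
  rcases Int.eq_nat_or_neg j with ⟨m, rfl | rfl⟩
  · exact oddFrac_sub_mem_of_nat hs hsB m (by omega)
  · have h := oddFrac_sub_mem_of_nat hs hsB m (by omega : m ≤ N)
    have h' := (oddRatSpan N B).smul_mem (-(-1) ^ s : ℚ) h
    convert h' using 1
    funext k
    have h0 := oddFrac_neg s 0 ((N : ℤ) + 1 + k)
    rw [neg_zero] at h0
    rw [Pi.smul_apply, Rat.smul_def, oddFrac_neg]
    push_cast
    linear_combination -h0

lemma oddFrac_zero_mem {N B s : ℕ} (hs : 2 ≤ s) (hsB : s ≤ B) :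
    (fun k : ℕ => oddFrac s 0 ((N : ℤ) + 1 + k)) ∈ oddRatSpan N B := by
  rcases Nat.even_or_odd s with h | h
  · convert (oddRatSpan N B).zero_mem using 1
    funext k
    simp [oddFrac_zero, h.neg_one_pow]
  · have h1 : shiftedZetaFun N s ∈ oddRatSpan N B := by
      refine Submodule.subset_span (Or.inl ⟨s, ⟨h, ?_, hsB⟩, rfl⟩)
      obtain ⟨m, rfl⟩ := h
      omega
    convert (oddRatSpan N B).smul_mem (2 : ℚ) h1 using 1
    funext k
    rw [oddFrac_zero, h.neg_one_pow, Pi.smul_apply, Rat.smul_def, shiftedZetaFun, zetaFun]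
    push_cast
    rw [add_right_comm]
    ring

/-- Odd rational functions with at least quadratic decay lie in `oddRatSpan`. -/
lemma IsCentralRat.mem_oddRatSpan {N B : ℕ} {f : ℤ → ℝ}
    (hf : IsCentralRat N B (B * (2 * N + 1) - 1) f)
    (hodd : ∀ x : ℤ, (N : ℤ) < |x| → f (-x) = -f x) :
    (fun k : ℕ => f ((N : ℤ) + 1 + k)) ∈ oddRatSpan N B := by
  obtain ⟨Q, hQ, hfQ⟩ := hf
  obtain ⟨c, hc, hpf⟩ := exists_partialFraction N B Q hQ
  set I := Finset.Icc (-N : ℤ) N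
  have hval : ∀ x : ℤ, (N : ℤ) < |x| →
      f x = ∑ j ∈ I, ∑ l ∈ Finset.range B, (c j l / 2 : ℝ) * oddFrac (l + 1) j x := by
    intro x hx
    have h1 := (hfQ x hx).trans (hpf x hx)
    have hx' : (N : ℤ) < |-x| := by rwa [abs_neg]
    have h2 := (hfQ (-x) hx').trans (hpf (-x) hx')
    have h3 : f x = (f x - f (-x)) / 2 := by rw [hodd x hx]; ring
    rw [h3, h1, h2, ← Finset.sum_sub_distrib, Finset.sum_div]
    refine Finset.sum_congr rfl fun j _ => ?_
    rw [← Finset.sum_sub_distrib, Finset.sum_div]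
    refine Finset.sum_congr rfl fun l _ => ?_
    unfold oddFrac
    push_cast
    rw [show -(x : ℝ) - j = -(x + j) by ring, one_div_neg_pow]
    ring
  have hsplit : (fun k : ℕ => f ((N : ℤ) + 1 + k)) =
      (∑ j ∈ I, ∑ l ∈ Finset.range B, (c j l / 2) • fun k : ℕ =>
        oddFrac (l + 1) j ((N : ℤ) + 1 + k) - oddFrac (l + 1) 0 ((N : ℤ) + 1 + k)) +
      ∑ l ∈ Finset.range B, ((∑ j ∈ I, c j l) / 2) • fun k : ℕ =>
        oddFrac (l + 1) 0 ((N : ℤ) + 1 + k) := by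
    funext k
    have hk : (N : ℤ) < |(N : ℤ) + 1 + k| := by rw [abs_of_nonneg (by positivity)]; omega
    rw [hval _ hk]
    simp only [Pi.add_apply, Finset.sum_apply, Pi.smul_apply, Rat.smul_def, mul_sub,
      Finset.sum_sub_distrib]
    have h4 : ∑ l ∈ Finset.range B, (((∑ j ∈ I, c j l) / 2 : ℚ) : ℝ) *
        oddFrac (l + 1) 0 ((N : ℤ) + 1 + k) = ∑ j ∈ I, ∑ l ∈ Finset.range B,
          ((c j l / 2 : ℚ) : ℝ) * oddFrac (l + 1) 0 ((N : ℤ) + 1 + k) := by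
      rw [Finset.sum_comm]
      refine Finset.sum_congr rfl fun l _ => ?_
      rw [← Finset.sum_mul, Finset.sum_div]
      push_cast
      rfl
    rw [h4]
    push_cast
    ring
  rw [hsplit]
  refine Submodule.add_mem _ (Submodule.sum_mem _ fun j hj => Submodule.sum_mem _ fun l hl =>
    Submodule.smul_mem _ _ (oddFrac_sub_mem (by omega) ?_ hj)) (Submodule.sum_mem _ fun l hl => ?_)
  · have := Finset.mem_range.1 hl; omega
  · have := Finset.mem_range.1 hl
    -- The term 1/x is absent because the residues add up to zero.
    rcases Nat.eq_zero_or_pos l with rfl | hl0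
    · rw [hc, zero_div, zero_smul]; exact Submodule.zero_mem _
    · exact Submodule.smul_mem _ _ (oddFrac_zero_mem (by omega) (by omega))

/-- Symmetry about -1/2: it makes u(x) - u(x - 1) odd and u(x) + u(x - 1) even. -/
lemma telePrim_neg (s i : ℕ) (x : ℤ) : telePrim s i (-x) = telePrim s i (x - 1) := by
  unfold telePrim
  push_cast
  rw [show -(x : ℝ) + 1 - i = -(x - 1 + i) by ring, show -(x : ℝ) + i = -(x - i) by ring,
    show (x : ℝ) - 1 + 1 - i = x - i by ring, one_div_neg_pow, neg_one_pow_div_neg_pow]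
  ring

lemma isCentralRat_telePrim {N B s i : ℕ} (hs : 1 ≤ s) (hsB : s ≤ B) (hi : 1 ≤ i) (hiN : i ≤ N) :
    IsCentralRat N B (B * (2 * N + 1)) (telePrim s i) ∧
      IsCentralRat N B (B * (2 * N + 1)) fun x => telePrim s i (x - 1) := by
  have key : ∀ j j' : ℤ, j ∈ Finset.Icc (-N : ℤ) N → j' ∈ Finset.Icc (-N : ℤ) N →
      IsCentralRat N B (B * (2 * N + 1)) fun x =>
        -(1 / ((x : ℝ) - j) ^ s + (-1) ^ s / ((x : ℝ) - j') ^ s) := by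
    intro j j' hj hj'
    have h := ((isCentralRat_inv_pow hj hs hsB).add
      ((isCentralRat_inv_pow hj' hs hsB).const_mul ((-1) ^ s))).const_mul (-1)
    convert h using 2 with x
    push_cast
    ring
  constructor
  · convert key (i - 1) (-i) (by simp; omega) (by simp; omega) using 2 with x
    unfold telePrim
    push_cast
    rw [sub_neg_eq_add, sub_sub_eq_add_sub, add_sub_right_comm]
  · convert key i (1 - i) (by simp; omega) (by simp; omega) using 2 with x
    unfold telePrim
    push_cast
    rw [sub_add_cancel, sub_sub_eq_add_sub]
    ring_nf

/-- The product of a function of `oddRatSpan` with an even function made of a primitive. -/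
lemma mul_telePrim_mem {N A s i : ℕ} (hs : 1 ≤ s) (hsA : s ≤ A) (hi : 1 ≤ i) (hiN : i ≤ N)
    {f : ℕ → ℝ} (hf : f ∈ oddRatSpan N A) :
    (fun k : ℕ => f k * (telePrim s i ((N : ℤ) + k) + telePrim s i ((N : ℤ) + (k + 1 : ℕ)))) ∈
      oddRatSpan N (2 * A) := by
  have hu := (isCentralRat_telePrim hs hsA hi hiN).1.add (isCentralRat_telePrim hs hsA hi hiN).2
  have key : ∀ F : ℤ → ℝ, IsCentralRat N A (A * (2 * N + 1)) F → (∀ x, F (-x) = -F x) →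
      (fun k : ℕ => F ((N : ℤ) + 1 + k) *
        (telePrim s i ((N : ℤ) + k) + telePrim s i ((N : ℤ) + (k + 1 : ℕ)))) ∈
      oddRatSpan N (2 * A) := by
    intro F hF hodd
    -- Each factor decays at least like 1/x, so the product has the quadratic decay needed for
    -- residues to add up to zero.
    have h := hF.mul hu
    have h' : IsCentralRat N (2 * A) (2 * A * (2 * N + 1) - 1)
        fun x => F x * (telePrim s i x + telePrim s i (x - 1)) := by
      convert h using 1 <;> ring_nf
    convert h'.mem_oddRatSpan ?_ using 1
    · funext k
      push_cast
      rw [show (N : ℤ) + 1 + k - 1 = N + k by ring, show (N : ℤ) + (k + 1) = N + 1 + k by ring]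
      ring
    · intro x _
      rw [hodd, telePrim_neg, show -x - 1 = -(x + 1) by ring, telePrim_neg, add_sub_cancel_right]
      ring
  induction hf using Submodule.span_induction with
  | mem f hf =>
    rcases hf with ⟨t, ⟨ht1, ht2, ht3⟩, rfl⟩ | ⟨t, j, ⟨ht1, ht2⟩, ⟨hj1, hj2⟩, rfl⟩
    · have h := key (fun x => 1 / (x : ℝ) ^ t) ?_ fun x => ?_
      · convert h using 3 with k
        simp only [shiftedZetaFun, zetaFun]
        push_cast
        rw [add_right_comm]
      · convert isCentralRat_inv_pow (N := N) (j := 0) (by simp) (by omega : 1 ≤ t) ht3 using 2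
        simp
      · push_cast
        rw [one_div_neg_pow, ht1.neg_one_pow]
        ring
    · have hT := isCentralRat_telePrim ht1 ht2 hj1 hj2
      have h := key (fun x => telePrim t j x - telePrim t j (x - 1)) ?_ fun x => ?_
      · convert h using 3 with k
        simp only [teleFun]
        rw [show (N : ℤ) + 1 + k - 1 = N + k by ring]
      · convert hT.1.add (hT.2.const_mul (-1)) using 2
        push_cast
        ring
      · rw [telePrim_neg, show -x - 1 = -(x + 1) by ring, telePrim_neg, add_sub_cancel_right]
        ring
  | zero => convert (oddRatSpan N (2 * A)).zero_mem using 1; funext k; simp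
  | add f g _ _ hf hg =>
    convert (oddRatSpan N (2 * A)).add_mem hf hg using 1
    funext k
    simp only [Pi.add_apply]
    ring
  | smul c f _ hf =>
    convert (oddRatSpan N (2 * A)).smul_mem c hf using 1
    funext k
    simp only [Pi.smul_apply, Rat.smul_def]
    ring

/-! ### Sums and pairings of odd rational functions -/

lemma rat_mem_oddZetaSpan (B : ℕ) (q : ℚ) : (q : ℝ) ∈ oddZetaSpan B := by
  have h : (1 : ℝ) ∈ oddZetaSpan B := Submodule.subset_span (Or.inl rfl)
  simpa [Rat.smul_def] using (oddZetaSpan B).smul_mem q h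

lemma oddZetaSpan_mono {B B' : ℕ} (h : ∀ s, Odd s → s ≤ B → s ≤ B') :
    oddZetaSpan B ≤ oddZetaSpan B' :=
  Submodule.span_mono (Set.union_subset_union_right _ fun _ ⟨s, h1, h2, h3, h4⟩ =>
    ⟨s, h1, h2, h s h1 h3, h4⟩)

lemma rat_mul_mem_oddZetaSpan {B : ℕ} (q : ℚ) {x : ℝ} (hx : x ∈ oddZetaSpan B) :
    (q : ℝ) * x ∈ oddZetaSpan B := by
  rw [← Rat.smul_def]
  exact (oddZetaSpan B).smul_mem q hx

lemma tsum_mem_oddZetaSpan {B N : ℕ} {f : ℕ → ℝ} (hf : Summable f) (hr : ∀ k, ∃ q : ℚ, f k = q)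
    (h : ∑' k, f (N + k) ∈ oddZetaSpan B) : ∑' k, f k ∈ oddZetaSpan B := by
  rw [← hf.sum_add_tsum_nat_add N]
  refine Submodule.add_mem _ (Submodule.sum_mem _ fun k _ => ?_) ?_
  · obtain ⟨q, hq⟩ := hr k
    rw [hq]
    exact rat_mem_oddZetaSpan B q
  · simpa only [add_comm] using h

lemma tsum_sub_shift {H : ℕ → ℝ} (hH : Summable H) : ∑' k, (H (k + 1) - H k) = -H 0 := by
  have h1 := (summable_nat_add_iff 1).2 hH
  rw [h1.tsum_sub hH, hH.tsum_eq_zero_add]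
  ring

lemma summable_sub_shift {H : ℕ → ℝ} (hH : Summable H) : Summable fun k => H (k + 1) - H k :=
  ((summable_nat_add_iff 1).2 hH).sub hH

/-- Two telescoping sums: k < l gives H 0 - H l, k > l gives -H (l + 1), and k = l gives nothing. -/
lemma tsum_orderSign_mul_sub {H : ℕ → ℝ} (hH : Summable H) (l : ℕ) :
    ∑' k, orderSign k l * (H (k + 1) - H k) = H 0 - H l - H (l + 1) := by
  have hs : Summable fun k => orderSign k l * (H (k + 1) - H k) :=
    (summable_sub_shift hH).bdd_mul_real fun k => abs_orderSign_le k l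
  have h1 : ∑' k, orderSign (k + (l + 1)) l * (H (k + (l + 1) + 1) - H (k + (l + 1)))
      = -H (l + 1) := by
    have := tsum_sub_shift ((summable_nat_add_iff (l + 1)).2 hH)
    rw [zero_add] at this
    rw [← this]
    refine tsum_congr fun k => ?_
    rw [orderSign_of_lt (by omega), one_mul]
    congr 2
    omega
  have h2 : ∑ k ∈ Finset.range l, orderSign k l * (H (k + 1) - H k) = -(H l - H 0) := by
    rw [← Finset.sum_range_sub, ← Finset.sum_neg_distrib]
    refine Finset.sum_congr rfl fun k hk => ?_
    rw [orderSign_of_gt (Finset.mem_range.1 hk)]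
    ring
  rw [← hs.sum_add_tsum_nat_add (l + 1), h1, Finset.sum_range_succ, h2, orderSign_self]
  ring

lemma pairSum_sub_shift {H f : ℕ → ℝ} (hH : Summable H) (hf : Summable f) :
    pairSum (fun k => H (k + 1) - H k) f = ∑' l, f l * (H 0 - H l - H (l + 1)) := by
  have hs := summable_pairSum (summable_sub_shift hH) hf
  have hs' := (Equiv.prodComm ℕ ℕ).summable_iff.2 hs
  rw [pairSum, ← (Equiv.prodComm ℕ ℕ).tsum_eq]
  refine (hs'.tsum_prod).trans (tsum_congr fun l => ?_)
  rw [← tsum_orderSign_mul_sub hH l, ← tsum_mul_left]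
  refine tsum_congr fun k => ?_
  simp only [Function.comp, Equiv.prodComm_apply, Prod.swap]
  ring

lemma summable_mul_of_summable {H f : ℕ → ℝ} (hH : Summable H) (hf : Summable f) :
    Summable fun l => f l * H l :=
  ((summable_mul_of_summable_norm hf.norm hH.norm).comp_injective
    (i := fun l : ℕ => (l, l)) fun _ _ h => (Prod.mk.inj h).1)

lemma pairSum_sub_shift_mem {B : ℕ} {H f : ℕ → ℝ} (hH : Summable H) (hf : Summable f)
    (hq : ∃ q : ℚ, H 0 = q) (hfB : ∑' k, f k ∈ oddZetaSpan B)
    (h : ∑' l, f l * (H l + H (l + 1)) ∈ oddZetaSpan B) :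
    pairSum (fun k => H (k + 1) - H k) f ∈ oddZetaSpan B := by
  obtain ⟨q, hq⟩ := hq
  have hs : Summable fun l => f l * (H l + H (l + 1)) :=
    summable_mul_of_summable (hH.add ((summable_nat_add_iff 1).2 hH)) hf
  have h1 : pairSum (fun k => H (k + 1) - H k) f
      = q * ∑' k, f k - ∑' l, f l * (H l + H (l + 1)) := by
    rw [pairSum_sub_shift hH hf, ← tsum_mul_left, ← (hf.mul_left _).tsum_sub hs]
    refine tsum_congr fun l => ?_
    rw [hq]
    ring
  rw [h1]
  exact Submodule.sub_mem _ (rat_mul_mem_oddZetaSpan q hfB) h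

lemma exists_rat_telePrim (s i : ℕ) (x : ℤ) : ∃ q : ℚ, telePrim s i x = q :=
  ⟨-(1 / ((x : ℚ) + 1 - i) ^ s + (-1) ^ s / ((x : ℚ) + i) ^ s), by unfold telePrim; push_cast; rfl⟩

lemma exists_rat_zetaFun (s k : ℕ) : ∃ q : ℚ, zetaFun s k = q :=
  ⟨1 / ((k : ℚ) + 1) ^ s, by unfold zetaFun; push_cast; rfl⟩

lemma summable_telePrim {N s i : ℕ} (hs : 1 ≤ s) (hi : 1 ≤ i) (hiN : i ≤ N) :
    Summable fun k : ℕ => telePrim s i ((N : ℤ) + k) := by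
  have hZ := summable_zetaFun (le_refl 2)
  have hiN' : (i : ℝ) ≤ N := by exact_mod_cast hiN
  have hi' : (1 : ℝ) ≤ i := by exact_mod_cast hi
  have ha : ∀ k : ℕ, (k : ℝ) + 1 ≤ N + k + 1 - i := fun k => by linarith
  have hb : ∀ k : ℕ, (k : ℝ) + 1 ≤ N + k + i := fun k => by linarith
  rcases Nat.eq_or_lt_of_le hs with rfl | hs
  -- For s = 1 the two simple fractions have opposite signs, and their leading terms cancel.
  · refine Summable.of_norm_bounded (hZ.mul_left (2 * i - 1 : ℝ)) fun k => ?_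
    have hk : (0 : ℝ) < k + 1 := by positivity
    have h1 := hk.trans_le (ha k)
    have h2 := hk.trans_le (hb k)
    have h3 : telePrim 1 i ((N : ℤ) + k)
        = -((2 * i - 1) * (1 / (((N : ℝ) + k + 1 - i) * (N + k + i)))) := by
      unfold telePrim
      push_cast
      rw [pow_one, pow_one, pow_one]
      field_simp
      ring
    rw [h3, norm_neg, Real.norm_of_nonneg (by
      refine mul_nonneg (by linarith) ?_
      positivity)]
    refine mul_le_mul_of_nonneg_left ?_ (by linarith)
    unfold zetaFun
    refine one_div_le_one_div_of_le (by positivity) ?_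
    rw [sq]
    exact mul_le_mul (ha k) (hb k) hk.le h1.le
  · have key : ∀ y : ℕ → ℝ, (∀ k : ℕ, (k : ℝ) + 1 ≤ y k) → Summable fun k => 1 / y k ^ s := by
      intro y hy
      refine Summable.of_norm_bounded (summable_zetaFun hs) fun k => ?_
      have hk : (0 : ℝ) < k + 1 := by positivity
      have h1 := hk.trans_le (hy k)
      rw [Real.norm_of_nonneg (by positivity)]
      exact one_div_le_one_div_of_le (by positivity) (pow_le_pow_left₀ hk.le (hy k) s)
    refine (((key _ ha).add ((key _ hb).mul_left ((-1) ^ s))).neg).congr fun k => ?_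
    unfold telePrim
    push_cast
    ring

lemma summable_and_tsum_mem_of_mem_oddRatSpan {N B : ℕ} {f : ℕ → ℝ} (hf : f ∈ oddRatSpan N B) :
    Summable f ∧ ∑' k, f k ∈ oddZetaSpan B := by
  induction hf using Submodule.span_induction with
  | mem f hf =>
    rcases hf with ⟨s, ⟨h1, h2, h3⟩, rfl⟩ | ⟨s, i, ⟨h1, h2⟩, ⟨h3, h4⟩, rfl⟩
    · have hz := summable_zetaFun (by omega : 2 ≤ s)
      have hz' := (summable_nat_add_iff N).2 hz
      have hcomm : shiftedZetaFun N s = fun k => zetaFun s (k + N) :=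
        funext fun k => by rw [shiftedZetaFun, add_comm]
      rw [hcomm]
      refine ⟨hz', ?_⟩
      have h5 : ∑' k, zetaFun s (k + N)
          = multiZeta ![s] - ∑ k ∈ Finset.range N, zetaFun s k := by
        rw [multiZeta_singleton, ← hz.sum_add_tsum_nat_add N]
        ring
      rw [h5]
      refine Submodule.sub_mem _ (Submodule.subset_span (Or.inr ⟨s, h1, h2, h3, rfl⟩))
        (Submodule.sum_mem _ fun k _ => ?_)
      obtain ⟨q, hq⟩ := exists_rat_zetaFun s k
      rw [hq]
      exact rat_mem_oddZetaSpan B q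
    · obtain ⟨H, hHk⟩ : ∃ H : ℕ → ℝ, ∀ k : ℕ, H k = telePrim s i ((N : ℤ) + k) :=
        ⟨_, fun _ => rfl⟩
      have hH : Summable H := (summable_telePrim h1 h3 h4).congr fun k => (hHk k).symm
      have hT : teleFun N s i = fun k : ℕ => H (k + 1) - H k := by
        funext k
        rw [teleFun, hHk, hHk]
        push_cast
        rw [add_right_comm, add_assoc]
      rw [hT]
      refine ⟨summable_sub_shift hH, ?_⟩
      rw [tsum_sub_shift hH]
      obtain ⟨q, hq⟩ := exists_rat_telePrim s i ((N : ℤ) + (0 : ℕ))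
      rw [hHk, hq]
      exact Submodule.neg_mem _ (rat_mem_oddZetaSpan B q)
  | zero => exact ⟨summable_zero, by simp⟩
  | add f g _ _ hf hg =>
    refine ⟨hf.1.add hg.1, ?_⟩
    simp only [Pi.add_apply]
    rw [hf.1.tsum_add hg.1]
    exact Submodule.add_mem _ hf.2 hg.2
  | smul c f _ hf =>
    have h : c • f = fun k => (c : ℝ) * f k := funext fun k => by simp [Rat.smul_def]
    rw [h]
    refine ⟨hf.1.mul_left _, ?_⟩
    rw [tsum_mul_left]
    exact rat_mul_mem_oddZetaSpan c hf.2

/-! ### Generators on the positive integers -/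

/-- Move a function `N` places to the right, and extend it by zero. -/
noncomputable def moveRight (N : ℕ) (f : ℕ → ℝ) (k : ℕ) : ℝ := if k < N then 0 else f (k - N)

/-- Generators, as functions of `k` where `x = k + 1` runs through the positive integers. -/
def generators (N A : ℕ) : Set (ℕ → ℝ) :=
  {f | ∃ s, (Odd s ∧ 3 ≤ s ∧ s ≤ A) ∧ f = zetaFun s} ∪
    ({f | ∃ j < N, f = Pi.single j 1} ∪
      {f | ∃ s i, (1 ≤ s ∧ s ≤ A) ∧ (1 ≤ i ∧ i ≤ N) ∧ f = moveRight N (teleFun N s i)})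

lemma generators_tail_mem {N A : ℕ} {f : ℕ → ℝ} (hf : f ∈ generators N A) :
    (fun k => f (N + k)) ∈ oddRatSpan N A := by
  rcases hf with ⟨s, hs, rfl⟩ | ⟨j, hj, rfl⟩ | ⟨s, i, hs, hi, rfl⟩
  · exact Submodule.subset_span (Or.inl ⟨s, hs, rfl⟩)
  · convert (oddRatSpan N A).zero_mem using 1
    funext k
    rw [Pi.single_eq_of_ne (by omega)]
    rfl
  · refine Submodule.subset_span (Or.inr ⟨s, i, hs, hi, ?_⟩)
    funext k
    simp [moveRight]

lemma generators_rat {N A : ℕ} {f : ℕ → ℝ} (hf : f ∈ generators N A) (k : ℕ) :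
    ∃ q : ℚ, f k = q := by
  rcases hf with ⟨s, hs, rfl⟩ | ⟨j, hj, rfl⟩ | ⟨s, i, hs, hi, rfl⟩
  · exact exists_rat_zetaFun s k
  · exact ⟨(Pi.single j 1 : ℕ → ℚ) k, by simp only [Pi.single_apply]; split_ifs <;> simp⟩
  · unfold moveRight teleFun
    split_ifs
    · exact ⟨0, by simp⟩
    · obtain ⟨q, hq⟩ := exists_rat_telePrim s i ((N : ℤ) + 1 + (k - N : ℕ))
      obtain ⟨q', hq'⟩ := exists_rat_telePrim s i ((N : ℤ) + (k - N : ℕ))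
      exact ⟨q - q', by rw [hq, hq']; push_cast; rfl⟩

lemma generators_summable {N A : ℕ} {f : ℕ → ℝ} (hf : f ∈ generators N A) : Summable f := by
  rw [← summable_nat_add_iff N]
  refine (summable_and_tsum_mem_of_mem_oddRatSpan (generators_tail_mem hf)).1.congr fun k => ?_
  rw [add_comm]

lemma generators_tsum_mem {N A : ℕ} {f : ℕ → ℝ} (hf : f ∈ generators N A) :
    ∑' k, f k ∈ oddZetaSpan (2 * A - 1) :=
  oddZetaSpan_mono (fun s _ h => by omega) (tsum_mem_oddZetaSpan (generators_summable hf)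
    (generators_rat hf) (summable_and_tsum_mem_of_mem_oddRatSpan (generators_tail_mem hf)).2)

/-- Every generator other than a zeta function is the difference of a summable H with rational H 0,
so its total is rational and its pairings reduce to single sums. -/
lemma generators_pairSum_mem {N A : ℕ} {g : ℕ → ℝ} (hg : g ∈ generators N A) :
    (∃ s, (Odd s ∧ 3 ≤ s ∧ s ≤ A) ∧ g = zetaFun s) ∨
      ((∃ q : ℚ, ∑' k, g k = q) ∧
        ∀ f ∈ generators N A, pairSum g f ∈ oddZetaSpan (2 * A - 1)) := by
  suffices h : (∃ s, (Odd s ∧ 3 ≤ s ∧ s ≤ A) ∧ g = zetaFun s) ∨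
      ∃ H : ℕ → ℝ, Summable H ∧ (∃ q : ℚ, H 0 = q) ∧ (g = fun k => H (k + 1) - H k) ∧
        ∀ f ∈ generators N A, ∑' l, f l * (H l + H (l + 1)) ∈ oddZetaSpan (2 * A - 1) by
    refine h.imp_right ?_
    rintro ⟨H, hH, ⟨q, hq⟩, rfl, hf⟩
    refine ⟨⟨-q, ?_⟩, fun f hfG => pairSum_sub_shift_mem hH (generators_summable hfG) ⟨q, hq⟩
      (generators_tsum_mem hfG) (hf f hfG)⟩
    rw [tsum_sub_shift hH, hq]
    push_cast
    rfl
  rcases hg with hg | ⟨j, hj, rfl⟩ | ⟨s, i, hs, hi, rfl⟩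
  · exact Or.inl hg
  · right
    obtain ⟨H, hH⟩ : ∃ H : ℕ → ℝ, ∀ k, H k = if k ≤ j then -1 else 0 := ⟨_, fun _ => rfl⟩
    refine ⟨H, ?_, ⟨-1, by simp [hH]⟩, ?_, fun f hf => ?_⟩
    · refine summable_of_ne_finset_zero (s := Finset.range (j + 1)) fun k hk => ?_
      rw [Finset.mem_range] at hk
      rw [hH, if_neg (by omega)]
    · funext k
      rw [Pi.single_apply, hH, hH]
      split_ifs <;> first | omega | norm_num
    · rw [tsum_eq_sum (s := Finset.range (j + 1)) fun k hk => by
        rw [Finset.mem_range] at hk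
        rw [hH, hH, if_neg (by omega), if_neg (by omega)]
        ring]
      refine Submodule.sum_mem _ fun k _ => ?_
      obtain ⟨q, hq⟩ := generators_rat hf k
      have hHq : ∀ k, ∃ q : ℚ, H k = q := fun k =>
        ⟨if k ≤ j then -1 else 0, by rw [hH]; split_ifs <;> simp⟩
      obtain ⟨q₁, hq₁⟩ := hHq k
      obtain ⟨q₂, hq₂⟩ := hHq (k + 1)
      have := rat_mem_oddZetaSpan (2 * A - 1) (q * (q₁ + q₂))
      rw [hq, hq₁, hq₂]
      push_cast at this
      exact this
  · right
    have hmax : ∀ k : ℕ, ((max N (N + k) : ℕ) : ℤ) = (N : ℤ) + k := fun k => by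
      rw [max_eq_right (by omega)]; push_cast; rfl
    -- Freezing the primitive below N makes its difference vanish there, as the extension by zero
    -- requires.
    have hH : Summable fun k : ℕ => telePrim s i (max N k : ℕ) := by
      rw [← summable_nat_add_iff N]
      refine (summable_telePrim (N := N) hs.1 hi.1 hi.2).congr fun k => ?_
      rw [add_comm k N, hmax]
    refine ⟨_, hH, exists_rat_telePrim _ _ _, ?_, fun f hf => ?_⟩
    · funext k
      unfold moveRight teleFun
      split_ifs with hk
      · rw [max_eq_left (by omega), max_eq_left (by omega), sub_self]
      · rw [max_eq_right (by omega), max_eq_right (by omega)]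
        congr 2
        · push_cast [Nat.cast_sub (not_lt.1 hk)]
          ring
        · push_cast [Nat.cast_sub (not_lt.1 hk)]
          ring
    · have hp := summable_and_tsum_mem_of_mem_oddRatSpan
        (mul_telePrim_mem hs.1 hs.2 hi.1 hi.2 (generators_tail_mem hf))
      have hsum : Summable fun l => f l *
          (telePrim s i (max N l : ℕ) + telePrim s i (max N (l + 1) : ℕ)) :=
        summable_mul_of_summable (hH.add ((summable_nat_add_iff 1).2 hH)) (generators_summable hf)
      refine tsum_mem_oddZetaSpan (N := N) hsum (fun k => ?_) ?_
      · obtain ⟨q, hq⟩ := generators_rat hf k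
        obtain ⟨q₁, hq₁⟩ := exists_rat_telePrim s i (max N k : ℕ)
        obtain ⟨q₂, hq₂⟩ := exists_rat_telePrim s i (max N (k + 1) : ℕ)
        exact ⟨q * (q₁ + q₂), by rw [hq, hq₁, hq₂]; push_cast; rfl⟩
      -- Poles have order up to 2A, but an odd exponent at most 2A is at most 2A - 1.
      · refine oddZetaSpan_mono (B := 2 * A) (fun t ht h => ?_) ?_
        · obtain ⟨u, rfl⟩ := ht
          omega
        · convert hp.2 using 4 with k
          rw [add_assoc N k 1, hmax, hmax]

/-- The truncation of 1/x^s to x > N differs from the full function by N point masses with rational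
weights. -/
lemma moveRight_mem {N A : ℕ} {f : ℕ → ℝ} (hf : f ∈ oddRatSpan N A) :
    moveRight N f ∈ Submodule.span ℚ (generators N A) := by
  induction hf using Submodule.span_induction with
  | mem f hf =>
    rcases hf with ⟨s, hs, rfl⟩ | ⟨s, i, hs, hi, rfl⟩
    · have h : moveRight N (shiftedZetaFun N s) = zetaFun s -
          ∑ j ∈ Finset.range N, (1 / ((j : ℚ) + 1) ^ s) • (Pi.single j 1 : ℕ → ℝ) := by
        funext k
        simp only [Pi.sub_apply, Finset.sum_apply, Pi.smul_apply, Pi.single_apply, Rat.smul_def,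
          mul_ite, mul_one, mul_zero, Finset.sum_ite_eq, Finset.mem_range, moveRight,
          shiftedZetaFun]
        split_ifs with hk
        · unfold zetaFun
          push_cast
          ring
        · rw [Nat.add_sub_cancel' (not_lt.1 hk), sub_zero]
      rw [h]
      refine Submodule.sub_mem _ (Submodule.subset_span (Or.inl ⟨s, hs, rfl⟩))
        (Submodule.sum_mem _ fun j hj => Submodule.smul_mem _ _ (Submodule.subset_span
          (Or.inr (Or.inl ⟨j, Finset.mem_range.1 hj, rfl⟩))))
    · exact Submodule.subset_span (Or.inr (Or.inr ⟨s, i, hs, hi, rfl⟩))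
  | zero =>
    convert (Submodule.span ℚ (generators N A)).zero_mem using 1
    funext k
    simp [moveRight]
  | add f g _ _ hf hg =>
    convert Submodule.add_mem _ hf hg using 1
    funext k
    simp only [moveRight, Pi.add_apply]
    split_ifs <;> simp
  | smul c f _ hf =>
    convert Submodule.smul_mem _ c hf using 1
    funext k
    simp only [moveRight, Pi.smul_apply]
    split_ifs <;> simp

/-- Alternating sums of odd rational functions are combinations of products of zeta values. -/
lemma altSum_mem_of_mem_oddRatSpan {N A p : ℕ} {g : Fin p → ℕ → ℝ}
    (hg : ∀ i, g i ∈ oddRatSpan N A) : altSum g ∈ Submodule.span ℚ (zetaProducts A p) := by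
  have h := altSum_shift N (fun i => moveRight N (g i)) fun i k hk => by simp [moveRight, hk]
  have h' : (fun i k => moveRight N (g i) (N + k)) = g := by
    funext i k
    simp [moveRight]
  rw [h'] at h
  rw [h]
  exact altSum_mem_of_span (fun _ => generators_summable)
    (altSum_mem_of_generators (fun _ => generators_summable) (fun _ => generators_pairSum_mem) p)
    _ fun i => moveRight_mem (hg i)

/-! ### Sign-equivariant summands -/

/-- A function of tuples changes by the sign under every permutation of its arguments. -/
def IsSignEquivariant {p : ℕ} (f : (Fin p → ℕ) → ℝ) : Prop :=
  ∀ (x : Fin p → ℕ) (σ : Equiv.Perm (Fin p)), f (x ∘ σ) = ((Equiv.Perm.sign σ : ℤ) : ℝ) * f x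

lemma IsSignEquivariant.eq_zero {p : ℕ} {f : (Fin p → ℕ) → ℝ} (hf : IsSignEquivariant f)
    {x : Fin p → ℕ} (h : ¬ Function.Injective x) : f x = 0 := by
  simp only [Function.Injective, not_forall] at h
  obtain ⟨a, b, hab, hne⟩ := h
  have h1 := hf x (Equiv.swap a b)
  have h2 : x ∘ Equiv.swap a b = x := by
    funext i
    simp only [Function.comp, Equiv.swap_apply_def]
    split_ifs with h3 h4 <;> simp_all
  rw [h2, Equiv.Perm.sign_swap hne] at h1
  push_cast at h1
  linarith

lemma IsSignEquivariant.tsum_signProd_mul {p : ℕ} {f : (Fin p → ℕ) → ℝ}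
    (hf : IsSignEquivariant f) (hs : Summable f) :
    ∑' x, signProd x * f x = (p.factorial : ℝ) * ∑' x : {x : Fin p → ℕ // StrictAnti x}, f x.1 := by
  rw [sum_eq_sum_perm_strictAnti (hs.bdd_mul_real abs_signProd_le)
    fun x hx => by rw [hf.eq_zero hx, mul_zero]]
  have h : ∀ σ : Equiv.Perm (Fin p), ∑' x : {x : Fin p → ℕ // StrictAnti x},
      signProd (x.1 ∘ σ) * f (x.1 ∘ σ) = ∑' x : {x : Fin p → ℕ // StrictAnti x}, f x.1 := by
    intro σ
    refine tsum_congr fun x => ?_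
    have h2 : ((Equiv.Perm.sign σ : ℤ) : ℝ) * ((Equiv.Perm.sign σ : ℤ) : ℝ) = 1 := by
      rw [← Int.cast_mul, ← Units.val_mul, Int.units_mul_self]
      simp
    rw [signProd_comp_perm, signProd_of_strictAnti x.2, hf]
    linear_combination (f x.1) * h2
  simp [h, Fintype.card_perm]

/-- Sums over weakly decreasing tuples of positive integers, in terms of all tuples. -/
lemma IsSignEquivariant.tsum_antitone {p : ℕ} {f : (Fin p → ℕ) → ℝ}
    (hf : IsSignEquivariant fun x => f fun i => x i + 1)
    (hs : Summable fun x : Fin p → ℕ => f fun i => x i + 1) :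
    Summable (fun k : {k : Fin p → ℕ // Antitone k ∧ ∀ i, 1 ≤ k i} => f k.1) ∧
      ∑' x : Fin p → ℕ, signProd x * f (fun i => x i + 1) = (p.factorial : ℝ) *
        ∑' k : {k : Fin p → ℕ // Antitone k ∧ ∀ i, 1 ≤ k i}, f k.1 := by
  let φ : {x : Fin p → ℕ // StrictAnti x} → {k : Fin p → ℕ // Antitone k ∧ ∀ i, 1 ≤ k i} :=
    fun x => ⟨fun i => x.1 i + 1, fun a b h => Nat.succ_le_succ (x.2.antitone h),
      fun i => Nat.le_add_left 1 _⟩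
  have hφ : Function.Injective φ := by
    rintro ⟨x, hx⟩ ⟨y, hy⟩ h
    have h' := congrArg Subtype.val h
    refine Subtype.ext (funext fun i => ?_)
    exact Nat.succ_injective (congrFun h' i)
  have hsupp : ∀ k ∉ Set.range φ, f k.1 = 0 := by
    rintro ⟨k, hk, hk1⟩ hnot
    have hk' : (fun i => k i - 1 + 1) = k := funext fun i => Nat.sub_add_cancel (hk1 i)
    by_contra hne
    refine hnot ⟨⟨fun i => k i - 1, ?_⟩, Subtype.ext hk'⟩
    have hinj : Function.Injective fun i => k i - 1 := by
      by_contra h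
      have h0 := hf.eq_zero h
      exact hne (by simpa only [hk'] using h0)
    have hanti : Antitone fun i => k i - 1 := fun a b h => Nat.sub_le_sub_right (hk h) 1
    exact hanti.strictAnti_of_injective hinj
  constructor
  · rw [← hφ.summable_iff hsupp]
    exact hs.comp_injective (i := fun x : {x : Fin p → ℕ // StrictAnti x} => x.1)
      Subtype.val_injective
  · rw [hf.tsum_signProd_mul hs,
      ← hφ.tsum_eq (f := fun k : {k : Fin p → ℕ // Antitone k ∧ ∀ i, 1 ≤ k i} => f k.1)
        (fun k hk => by_contra fun h => hk (hsupp k h))]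

/-! ### The series in centred variables -/

open Polynomial in
lemma aeval_centralPoly_neg (N : ℕ) (x : ℝ) :
    aeval (-x) (centralPoly N) = -aeval x (centralPoly N) := by
  rw [aeval_centralPoly, aeval_centralPoly,
    Finset.prod_equiv (Equiv.neg ℤ) (t := Finset.Icc (-N : ℤ) N) (g := fun j => -(x - (j : ℝ)))
      (fun j => by simp only [Finset.mem_Icc, Equiv.neg_apply]; omega)
      (fun j _ => by simp; ring), Finset.prod_neg, Int.card_Icc]
  have : ((N : ℤ) + 1 - -N).toNat = 2 * N + 1 := by omega
  rw [this, (odd_two_mul_add_one N).neg_one_pow, neg_one_mul]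

open Polynomial in
lemma aeval_centralPoly_succ (N : ℕ) (x : ℝ) :
    aeval x (centralPoly (N + 1)) = aeval x (centralPoly N) * (x ^ 2 - ((N : ℝ) + 1) ^ 2) := by
  rw [aeval_centralPoly, aeval_centralPoly]
  have h : Finset.Icc (-(N + 1 : ℕ) : ℤ) (N + 1 : ℕ)
      = insert (-(N + 1 : ℤ)) (insert (N + 1 : ℤ) (Finset.Icc (-N : ℤ) N)) := by
    ext j
    simp only [Finset.mem_Icc, Finset.mem_insert]
    omega
  rw [h, Finset.prod_insert (by simp; omega), Finset.prod_insert (by simp)]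
  push_cast
  ring

open Polynomial in
lemma poch_eq_aeval_centralPoly (N : ℕ) (x : ℝ) :
    poch (x - N) (2 * N + 1) = aeval x (centralPoly N) := by
  have hprod : ∀ (y : ℝ) (m : ℕ), (ascPochhammer ℝ m).eval y = ∏ l ∈ Finset.range m, (y + l) := by
    intro y m
    induction m with
    | zero => simp
    | succ m ih => rw [ascPochhammer_succ_eval, ih, Finset.prod_range_succ]
  rw [poch, hprod, aeval_centralPoly]
  refine Finset.prod_nbij' (fun l : ℕ => (N : ℤ) - l) (fun j => ((N : ℤ) - j).toNat) ?_ ?_ ?_ ?_ ?_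
  · intro l hl; simp at hl ⊢; omega
  · intro l hl; simp at hl ⊢; omega
  · intro l hl; simp
  · intro l hl; simp at hl ⊢; omega
  · intro l hl; push_cast; ring

/-- The two-variable interaction factor, as a polynomial in the squares of the variables. -/
noncomputable def pairPoly {p : ℕ} (r : ℕ) (i j : Fin p) : MvPolynomial (Fin p) ℚ :=
  (MvPolynomial.X i - MvPolynomial.X j) * ∏ l ∈ Finset.range r,
    ((MvPolynomial.X i - MvPolynomial.X j) ^ 2 -
      MvPolynomial.C (2 * ((l : ℚ) + 1) ^ 2) * (MvPolynomial.X i + MvPolynomial.X j) +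
      MvPolynomial.C (((l : ℚ) + 1) ^ 4))

open Polynomial in
-- The factors for ±m combine: ((a - b)² - m²)((a + b)² - m²) = (a² - b²)² - 2m²(a² + b²) + m⁴, and
-- m = 0 gives a² - b².
lemma aeval_pairPoly {p : ℕ} (r : ℕ) (i j : Fin p) (x : Fin p → ℝ) :
    MvPolynomial.aeval (fun i => x i ^ 2) (pairPoly r i j) =
      aeval (x i - x j) (centralPoly r) * aeval (x i + x j) (centralPoly r) := by
  induction r with
  | zero =>
    simp [pairPoly, centralPoly]
    ring
  | succ r ih =>
    have h : pairPoly (r + 1) i j = pairPoly r i j *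
        ((MvPolynomial.X i - MvPolynomial.X j) ^ 2 -
          MvPolynomial.C (2 * ((r : ℚ) + 1) ^ 2) * (MvPolynomial.X i + MvPolynomial.X j) +
          MvPolynomial.C (((r : ℚ) + 1) ^ 4)) := by
      rw [pairPoly, Finset.prod_range_succ, ← mul_assoc, ← pairPoly]
    rw [h, map_mul, ih, aeval_centralPoly_succ, aeval_centralPoly_succ]
    simp only [map_add, map_sub, map_mul, map_pow, MvPolynomial.aeval_X, MvPolynomial.aeval_C,
      eq_ratCast]
    push_cast
    ring

lemma degreeOf_pairPoly_le {p : ℕ} (r : ℕ) (i j m : Fin p) :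
    MvPolynomial.degreeOf m (pairPoly r i j) ≤
      (2 * r + 1) * ((if m = i then 1 else 0) + if m = j then 1 else 0) := by
  set d := (if m = i then 1 else 0) + if m = j then 1 else 0 with hd
  have hX : ∀ a : Fin p, MvPolynomial.degreeOf m (MvPolynomial.X a : MvPolynomial (Fin p) ℚ)
      = if m = a then 1 else 0 := fun a => by rw [MvPolynomial.degreeOf_X]
  have h1 : MvPolynomial.degreeOf m (MvPolynomial.X i - MvPolynomial.X j :
      MvPolynomial (Fin p) ℚ) ≤ d :=
    (MvPolynomial.degreeOf_sub_le m _ _).trans (by rw [hX, hX]; omega)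
  have h2 : MvPolynomial.degreeOf m (MvPolynomial.X i + MvPolynomial.X j :
      MvPolynomial (Fin p) ℚ) ≤ d :=
    (MvPolynomial.degreeOf_add_le m _ _).trans (by rw [hX, hX]; omega)
  have h3 : ∀ l ∈ Finset.range r, MvPolynomial.degreeOf m
      ((MvPolynomial.X i - MvPolynomial.X j) ^ 2 -
      MvPolynomial.C (2 * ((l : ℚ) + 1) ^ 2) * (MvPolynomial.X i + MvPolynomial.X j) +
      MvPolynomial.C (((l : ℚ) + 1) ^ 4) : MvPolynomial (Fin p) ℚ) ≤ 2 * d := by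
    intro l _
    refine (MvPolynomial.degreeOf_add_le m _ _).trans (max_le ?_ ?_)
    · refine (MvPolynomial.degreeOf_sub_le m _ _).trans (max_le ?_ ?_)
      · exact (MvPolynomial.degreeOf_pow_le m _ _).trans (Nat.mul_le_mul_left 2 h1)
      · exact (MvPolynomial.degreeOf_C_mul_le _ m _).trans (h2.trans (by omega))
    · rw [MvPolynomial.degreeOf_C]; omega
  refine (MvPolynomial.degreeOf_mul_le m _ _).trans ?_
  have h4 := (MvPolynomial.degreeOf_prod_le m (Finset.range r) _).trans (Finset.sum_le_sum h3)
  rw [Finset.sum_const, Finset.card_range, smul_eq_mul] at h4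
  calc _ ≤ d + r * (2 * d) := add_le_add h1 h4
    _ = _ := by ring

/-- The index m lies in p - 1 pairs, each contributing degree at most 2r + 1. -/
lemma degreeOf_prod_pairPoly_le {p : ℕ} (r : ℕ) (m : Fin p) :
    MvPolynomial.degreeOf m (∏ i, ∏ j ∈ Finset.Ioi i, pairPoly r i j) ≤ (2 * r + 1) * (p - 1) := by
  have h1 : ∑ i : Fin p, ∑ j ∈ Finset.Ioi i,
      ((if m = i then 1 else 0) + if m = j then 1 else 0) = p - 1 := by
    simp only [Finset.sum_add_distrib, Finset.sum_ite_eq, Finset.mem_Ioi, Finset.sum_const,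
      smul_eq_mul, mul_ite, mul_one, mul_zero, Finset.mem_univ, if_true, Fin.card_Ioi]
    have h2 : ∑ i : Fin p, (if i < m then 1 else 0) = (m : ℕ) := by
      rw [← Finset.sum_filter, Finset.sum_const, smul_eq_mul, mul_one, Finset.filter_gt_eq_Iio,
        Fin.card_Iio]
    rw [h2]
    have := m.2
    omega
  rw [← h1, Finset.mul_sum]
  refine (MvPolynomial.degreeOf_prod_le m _ _).trans (Finset.sum_le_sum fun i _ => ?_)
  rw [Finset.mul_sum]
  exact (MvPolynomial.degreeOf_prod_le m _ _).trans
    (Finset.sum_le_sum fun j _ => degreeOf_pairPoly_le r i j m)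

open Polynomial in
/-- The one-variable factors of the series. -/
noncomputable def weightFun (N t ε A a : ℕ) (x : ℤ) : ℝ :=
  aeval (x : ℝ) (X ^ ε * centralPoly (N + t) * (X ^ 2) ^ a : ℚ[X]) /
    aeval (x : ℝ) (centralPoly N) ^ A

open Polynomial in
lemma weightFun_mem {N t ε A a : ℕ} (hε : Odd (ε + 1 + A))
    (hdeg : ε + 2 * a + 2 * t + 2 ≤ (A - 1) * (2 * N + 1)) (hA : 1 ≤ A) :
    (fun k : ℕ => weightFun N t ε A a ((N : ℤ) + 1 + k)) ∈ oddRatSpan N A := by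
  refine IsCentralRat.mem_oddRatSpan ⟨_, ?_, fun x _ => rfl⟩ fun x _ => ?_
  · have hm1 : (X ^ ε * centralPoly (N + t) : ℚ[X]).Monic :=
      (monic_X_pow ε).mul (centralPoly_monic _)
    have hm2 : ((X ^ 2) ^ a : ℚ[X]).Monic := (monic_X_pow 2).pow a
    rw [← natDegree_lt_iff_degree_lt (hm1.mul hm2).ne_zero, hm1.natDegree_mul hm2,
      (monic_X_pow ε).natDegree_mul (centralPoly_monic _), natDegree_centralPoly, natDegree_X_pow,
      ← pow_mul, natDegree_X_pow]
    obtain ⟨B, rfl⟩ := Nat.exists_eq_add_of_le' hA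
    rw [Nat.add_sub_cancel] at hdeg
    rw [add_mul]
    omega
  · have h1 : ((-1 : ℝ) ^ A) ≠ 0 := pow_ne_zero _ (by norm_num)
    -- Under x ↦ -x the numerator gains (-1)^(ε + 1) and the denominator (-1)^A, so the parity of ε
    -- + 1 + A gives oddness.
    have h2 : (-1 : ℝ) ^ ε * (-1) = -(-1) ^ A := by
      have h3 := hε.neg_one_pow (α := ℝ)
      rw [pow_add, pow_succ] at h3
      have h4 : ((-1 : ℝ) ^ A) * (-1) ^ A = 1 := by rw [← mul_pow]; simp
      linear_combination (-1 : ℝ) ^ A * h3 - ((-1 : ℝ) ^ ε * (-1)) * h4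
    unfold weightFun
    simp only [map_mul, map_pow, aeval_X]
    push_cast
    rw [aeval_centralPoly_neg, aeval_centralPoly_neg, neg_pow (x : ℝ) ε, neg_sq,
      neg_pow (aeval (x : ℝ) (centralPoly N)) A, ← neg_div]
    rw [← mul_div_mul_left (-_) _ h1]
    congr 1
    linear_combination ((x : ℝ) ^ ε * aeval (x : ℝ) (centralPoly (N + t)) * ((x : ℝ) ^ 2) ^ a) * h2

open Polynomial in
lemma seriesTerm_eq (N r t ε A p : ℕ) (k : Fin p → ℕ) :
    seriesTerm (N + N) r t ε A p (fun i => k i + 1) =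
      (∏ i, weightFun N t ε A 0 ((N : ℤ) + 1 + k i)) *
        ∏ i, ∏ j ∈ Finset.Ioi i,
          (aeval (((N : ℝ) + 1 + k i) - (N + 1 + k j)) (centralPoly r) *
            aeval (((N : ℝ) + 1 + k i) + (N + 1 + k j)) (centralPoly r)) := by
  unfold seriesTerm weightFun
  have h1 : ∀ i j : Fin p, poch (((k i + 1 : ℕ) : ℝ) - (k j + 1 : ℕ) - r) (2 * r + 1) *
      poch (((k i + 1 : ℕ) : ℝ) + (k j + 1 : ℕ) + (N + N : ℕ) - r) (2 * r + 1) =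
      aeval (((N : ℝ) + 1 + k i) - (N + 1 + k j)) (centralPoly r) *
        aeval (((N : ℝ) + 1 + k i) + (N + 1 + k j)) (centralPoly r) := by
    intro i j
    rw [poch_eq_aeval_centralPoly, poch_eq_aeval_centralPoly]
    congr 3 <;> (push_cast; ring)
  have h2 : ∀ i, poch (((k i + 1 : ℕ) : ℝ) - t) (2 * t + (N + N) + 1) =
      aeval ((N : ℝ) + 1 + k i) (centralPoly (N + t)) := by
    intro i
    rw [← poch_eq_aeval_centralPoly]
    congr 1
    · push_cast; ring
    · ring
  have h3 : ∀ i, poch ((k i + 1 : ℕ) : ℝ) ((N + N) + 1) =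
      aeval ((N : ℝ) + 1 + k i) (centralPoly N) := by
    intro i
    rw [← poch_eq_aeval_centralPoly]
    congr 1
    · push_cast; ring
    · ring
  simp only [h1, h2, h3, map_mul, map_pow, aeval_X, pow_zero, mul_one]
  rw [Finset.prod_div_distrib, Finset.prod_mul_distrib]
  simp only [Finset.prod_pow]
  have h4 : ∀ i, ((k i + 1 : ℕ) : ℝ) + ((N + N : ℕ) : ℝ) / 2 = (N : ℝ) + 1 + k i := by
    intro i; push_cast; ring
  simp only [h4]
  push_cast
  ring

lemma isSignEquivariant_seriesTerm (N r t ε A p : ℕ) :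
    IsSignEquivariant fun x : Fin p → ℕ => seriesTerm (N + N) r t ε A p fun i => x i + 1 := by
  intro x σ
  simp only [seriesTerm_eq, Function.comp]
  rw [Equiv.prod_comp σ fun i => weightFun N t ε A 0 ((N : ℤ) + 1 + x i),
    σ.prod_Ioi_comp_eq_sign_mul_prod (R := ℝ) (f := fun i j =>
      Polynomial.aeval (((N : ℝ) + 1 + x i) - (N + 1 + x j)) (centralPoly r) *
        Polynomial.aeval (((N : ℝ) + 1 + x i) + (N + 1 + x j)) (centralPoly r))]
  · ring
  · intro i j
    rw [← neg_sub, aeval_centralPoly_neg, add_comm ((N : ℝ) + 1 + x i)]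
    ring

lemma seriesTerm_eq_sum (N r t ε A p : ℕ) (k : Fin p → ℕ) :
    seriesTerm (N + N) r t ε A p (fun i => k i + 1) =
      ∑ d ∈ (∏ i : Fin p, ∏ j ∈ Finset.Ioi i, pairPoly r i j).support,
        ((MvPolynomial.coeff d (∏ i : Fin p, ∏ j ∈ Finset.Ioi i, pairPoly r i j) : ℚ) : ℝ) *
          ∏ i, weightFun N t ε A (d i) ((N : ℤ) + 1 + k i) := by
  set M := ∏ i : Fin p, ∏ j ∈ Finset.Ioi i, pairPoly r i j with hM
  have h1 : MvPolynomial.aeval (fun i => ((N : ℝ) + 1 + k i) ^ 2) M =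
      ∏ i, ∏ j ∈ Finset.Ioi i,
        (Polynomial.aeval (((N : ℝ) + 1 + k i) - (N + 1 + k j)) (centralPoly r) *
          Polynomial.aeval (((N : ℝ) + 1 + k i) + (N + 1 + k j)) (centralPoly r)) := by
    simp only [hM, map_prod, aeval_pairPoly r _ _ fun i => (N : ℝ) + 1 + k i]
  rw [seriesTerm_eq, ← h1, MvPolynomial.aeval_def, MvPolynomial.eval₂_eq', Finset.mul_sum]
  refine Finset.sum_congr rfl fun d _ => ?_
  rw [eq_ratCast, mul_left_comm, ← Finset.prod_mul_distrib]
  congr 1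
  refine Finset.prod_congr rfl fun i _ => ?_
  simp only [weightFun, map_mul, map_pow, Polynomial.aeval_X, pow_zero, mul_one]
  push_cast
  ring

theorem mainTheorem6 (n r t ε A p : ℕ) (hA : 1 ≤ A) (hp : 1 ≤ p) (hn : Even n)
    (hε : ε ≡ (A + 1) * (n + 1) + 1 [MOD 2])
    (hdeg : ε + (4 * r + 2) * p + 2 * t ≤ (A - 1) * (n + 1) + 4 * r) :
    Summable (fun k : {k : Fin p → ℕ // Antitone k ∧ ∀ i, 1 ≤ k i} =>
        seriesTerm n r t ε A p k.1) ∧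
      (∑' k : {k : Fin p → ℕ // Antitone k ∧ ∀ i, 1 ≤ k i}, seriesTerm n r t ε A p k.1) ∈
        Submodule.span ℚ (zetaProducts A p) := by
  obtain ⟨N, rfl⟩ := hn
  have hodd : Odd (ε + 1 + A) := by
    have h1 : (A + 1) * (N + N + 1) + 1 = 2 * ((A + 1) * N) + (A + 2) := by ring
    rw [h1] at hε
    have h2 : ε % 2 = (2 * ((A + 1) * N) + (A + 2)) % 2 := hε
    rw [Nat.odd_iff]
    omega
  set M := ∏ i : Fin p, ∏ j ∈ Finset.Ioi i, pairPoly r i j with hM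
  have hmem : ∀ d ∈ M.support, ∀ i : Fin p,
      (fun k : ℕ => weightFun N t ε A (d i) ((N : ℤ) + 1 + k)) ∈ oddRatSpan N A := by
    intro d hd i
    have h1 := (MvPolynomial.degreeOf_le_iff.1 (degreeOf_prod_pairPoly_le r i)) d hd
    refine weightFun_mem hodd ?_ hA
    obtain ⟨P, rfl⟩ := Nat.exists_eq_add_of_le' hp
    rw [Nat.add_sub_cancel] at h1
    rw [← two_mul] at hdeg
    -- Twice the largest exponent of x_i², namely (4r + 2)(p - 1), accounts for the 4r and leaves
    -- exactly the 2 that quadratic decay requires.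
    have h2 : (4 * r + 2) * (P + 1) = 2 * ((2 * r + 1) * P) + 4 * r + 2 := by ring
    omega
  have hsum : ∀ d ∈ M.support, ∀ i : Fin p,
      Summable fun k : ℕ => weightFun N t ε A (d i) ((N : ℤ) + 1 + k) := fun d hd i =>
    (summable_and_tsum_mem_of_mem_oddRatSpan (hmem d hd i)).1
  have hs : Summable fun x : Fin p → ℕ => seriesTerm (N + N) r t ε A p fun i => x i + 1 := by
    simp only [seriesTerm_eq_sum]
    exact summable_sum fun d hd => (summable_prod_apply (hsum d hd)).mul_left _
  have hmain := (isSignEquivariant_seriesTerm N r t ε A p).tsum_antitone hs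
  refine ⟨hmain.1, ?_⟩
  have halt : ∑' x : Fin p → ℕ, signProd x * seriesTerm (N + N) r t ε A p (fun i => x i + 1) =
      ∑ d ∈ M.support, (M.coeff d) •
        altSum fun i k => weightFun N t ε A (d i) ((N : ℤ) + 1 + (k : ℕ)) := by
    simp only [seriesTerm_eq_sum, Finset.mul_sum, ← hM]
    rw [Summable.tsum_finsetSum]
    · refine Finset.sum_congr rfl fun d hd => ?_
      rw [Rat.smul_def, altSum, ← tsum_mul_left]
      refine tsum_congr fun x => ?_
      ring
    · intro d hd
      exact ((summable_altSum (hsum d hd)).mul_left ((M.coeff d : ℚ) : ℝ)).congr fun x => by ring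
  have hin : (p.factorial : ℝ) * (∑' k : {k : Fin p → ℕ // Antitone k ∧ ∀ i, 1 ≤ k i},
      seriesTerm (N + N) r t ε A p k.1) ∈ Submodule.span ℚ (zetaProducts A p) := by
    rw [← hmain.2, halt]
    exact Submodule.sum_mem _ fun d hd =>
      Submodule.smul_mem _ _ (altSum_mem_of_mem_oddRatSpan (hmem d hd))
  have h := Submodule.smul_mem _ ((p.factorial : ℚ)⁻¹) hin
  rw [Rat.smul_def] at h
  push_cast at h
  rwa [inv_mul_cancel_left₀ (by exact_mod_cast p.factorial_ne_zero)] at h
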